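/- **Setting.** Agents $1,\dots,n$; a finite outcome space $\mathcal Y$ and a finite signal space $\mathcal X$. The outcome $Y$ has prior $p_0\in\Delta_{\mathcal Y}$; given $Y=y$ the signals $X_1,\dots,X_n$ are i.i.d. with law $P(\cdot\mid y)$. Each agent $i$ first chooses an effort $c_i\ge 0$. His signal then arrives after a latency $T_i\in[0,\infty]$ ($\infty$: it never arrives), which is independent of everything else given the effort and has c.d.f. $F_{c_i}(t)=P(T_i\le t)$. At any time $s_i$, before or after $T_i$, he may send one report $b_i$, a vector of non-negative likelihoods $(b_{i,y})_{y\in\mathcal Y}$; he need not report at all ($s_i=\infty$). At each time his decisions may depend on his own randomization, on his signal if it has arrived, and on all reports sent so far, which are public. **MVP market.** Each report updates the market belief by Bayes' rule $p_y\mapsto p_yb_{i,y}/\sum_z p_zb_{i,z}$, so that the belief at time $t$ is $p(t)_y\propto p_{0,y}\prod_{j:\,s_j<t}b_{j,y}$ (by convention $p(t)=p_0$ if these numbers all vanish). The counterfactual belief $\tilde p^i(t)$ is the same expression with the report of agent $i$ left out. With a real-valued strictly proper scoring rule $S$ on $\Delta_{\mathcal Y}\times\mathcal Y$ and a time value function $h$,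 the value of the information is $V=\int_{t>0}S(p(t),Y)h(t)\,dt$, and agent $i$ is paid $$r_i=\int_{t>0}\bigl(S(p(t),Y)-S(\tilde p^i(t),Y)\bigr)h(t)\,dt .$$ Agent $i$'s utility is $u_i=\mathbb E[r_i]-\mathbb E[c_i]$, and the social welfare is $W=\mathbb E[V]-\sum_i\mathbb E[c_i]$. (Deviations and profiles are compared only if the payoffs in question are integrable.) **Theorem.** Assume that $h(t)>0$ for all $t>0$, that $\int_{t>0}h(t)\,dt<\infty$, and that for every $t>0$ the function $c\mapsto F_c(t)$ is continuous on $[0,\infty)$ with $\frac{d^2F_c(t)}{dc^2}<0$ for all $c>0$. Then the MVP market is individually rational: in every Nash equilibrium every agent has non-negative expected utility. Moreover there is a strict perfect Bayesian equilibrium whose profile is symmetric and has the largest social welfare among all symmetric strategy profiles, and which satisfies: * *Effort optimality:* every agent invests the same effort $c^*$, and $c^*$ maximizes $c\mapsto\mathbb E[V]-nc$, where $\mathbb E[V]$ is computed for the profile in which all agents invest $c$ and all updates are truthful and timely. * *Truthfulness:* every report is the likelihood vector $b_{i,y}=P(X_i\mid Y=y)$, so that it is a Bayesian update of the market belief with the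 reporter's signal as evidence. * *Timeliness:* $s_i=T_i$ for all $i$. Here a profile is a *strict perfect Bayesian equilibrium* if, at the start and at every information set of an agent that is reached with positive probability (in continuous time: at every random time that the agent recognizes from what he has observed and that is finite with positive probability), no deviation of that agent from there on raises his conditional expected utility, and every such deviation that with positive probability changes his effort, or changes the market belief at some time, strictly lowers it. -/

import Mathlib

open MeasureTheory ProbabilityTheory Set
open scoped NNReal ENNReal

noncomputable section

namespace MVP

/-- `score` is a strictly proper scoring rule on the probability vectors over `𝒴`. -/
def StrictlyProper {𝒴 : Type*} [Fintype 𝒴] (score : stdSimplex ℝ 𝒴 → 𝒴 → ℝ) : Prop :=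
  (∀ b p : stdSimplex ℝ 𝒴, ∑ y, b.1 y * score p y ≤ ∑ y, b.1 y * score b y) ∧
  ∀ b p : stdSimplex ℝ 𝒴, ∑ y, b.1 y * score p y = ∑ y, b.1 y * score b y → b = p

/-- The data of the sequential setting: the prior of the outcome `Y`; the law of a signal given
`Y = y` (the same for all agents); the law of the latency at each effort, where `∞` means that the
signal never arrives; the scoring rule; and the time value function. -/
structure Model (𝒴 𝒳 : Type*) [Fintype 𝒴] where
  prior : stdSimplex ℝ 𝒴
  signal : 𝒴 → PMF 𝒳
  latency : Kernel ℝ≥0 ℝ≥0∞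
  score : stdSimplex ℝ 𝒴 → 𝒴 → ℝ
  weight : ℝ → ℝ

/-- A report `b` states, up to a common factor, a likelihood `b y` for every outcome `y`. -/
abbrev Report (𝒴 : Type*) := 𝒴 → ℝ≥0

/-- The time at which an agent reports (`∞` if he does not report) and his report. -/
abbrev Record (𝒴 : Type*) := ℝ≥0∞ × Report 𝒴

/-- One record for each agent. -/
abbrev History (n : ℕ) (𝒴 : Type*) := Fin n → Record 𝒴

/-- The record of an agent who has not reported. -/
def noRecord {𝒴 : Type*} : Record 𝒴 := (∞, 1)

/-! ### The mechanism

It uses only the prior, the scoring rule, the time value function, the reports and the outcome. -/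

section Mechanism

variable {𝒴 : Type*} [Fintype 𝒴]

open scoped Classical in
/-- Bayes' rule `p y ↦ p y * b y / ∑ z, p z * b z`. The belief is left alone where this is `0 / 0`.
For two outcomes and `b = (β, 1 - β)` the first coordinate of the result is
`p β / ((1 - p) (1 - β) + p β)`. -/
def bayesUpdate (p : stdSimplex ℝ 𝒴) (b : Report 𝒴) : stdSimplex ℝ 𝒴 :=
  if hb : ∑ z, p.1 z * b z = 0 then p
  else ⟨fun y => p.1 y * b y / ∑ z, p.1 z * b z,
    fun y => div_nonneg (mul_nonneg (p.2.1 y) (b y).2)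
      (Finset.sum_nonneg fun z _ => mul_nonneg (p.2.1 z) (b z).2),
    by rw [← Finset.sum_div]; exact div_self hb⟩

variable {n : ℕ}

open scoped Classical in
/-- The belief at time `t` from the reports that the agents in `K` have sent before `t`.
Successive Bayesian updates multiply the reports, in whatever order they come. -/
def beliefFrom (prior : stdSimplex ℝ 𝒴) (H : History n 𝒴) (K : Finset (Fin n)) (t : ℝ) :
    stdSimplex ℝ 𝒴 :=
  bayesUpdate prior (∏ j ∈ K with (H j).1 < ENNReal.ofReal t, (H j).2)

/-- The market belief `p(t)`. -/
def marketBelief (prior : stdSimplex ℝ 𝒴) (H : History n 𝒴) (t : ℝ) : stdSimplex ℝ 𝒴 :=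
  beliefFrom prior H Finset.univ t

/-- The counterfactual market belief at time `t` for the absence of agent `i`. -/
def counterfactualBelief (prior : stdSimplex ℝ 𝒴) (H : History n 𝒴) (i : Fin n) (t : ℝ) :
    stdSimplex ℝ 𝒴 :=
  beliefFrom prior H (Finset.univ.erase i) t

/-- The value of the belief history, `V = ∫_{t > 0} S(p(t), y) h(t) dt`. -/
def value (prior : stdSimplex ℝ 𝒴) (score : stdSimplex ℝ 𝒴 → 𝒴 → ℝ) (weight : ℝ → ℝ)
    (H : History n 𝒴) (y : 𝒴) : ℝ :=
  ∫ t in Ioi (0 : ℝ), score (marketBelief prior H t) y * weight t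

/-- The reward of agent `i` when the outcome is `y`. -/
def reward (prior : stdSimplex ℝ 𝒴) (score : stdSimplex ℝ 𝒴 → 𝒴 → ℝ) (weight : ℝ → ℝ)
    (H : History n 𝒴) (i : Fin n) (y : 𝒴) : ℝ :=
  ∫ t in Ioi (0 : ℝ),
    (score (marketBelief prior H t) y - score (counterfactualBelief prior H i t) y) * weight t

end Mechanism

/-! ### The game -/

/-- What nature and an agent's own randomization draw for him: the signal that he gets, a uniform
seed for randomizing, and the time at which the signal arrives. -/
abbrev Private (𝒳 : Type*) := 𝒳 × (unitInterval × ℝ≥0∞)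

/-- The outcome and the private draws of all agents. -/
abbrev World (n : ℕ) (𝒴 𝒳 : Type*) := 𝒴 × (Fin n → Private 𝒳)

/-- A strategy chooses an effort, and after every new observation plans when and what to report
unless something else is observed first. The plan depends on the public history of reports:
`early` is the plan while the signal has not arrived, `late` the plan once it has arrived (it also
depends on the arrival time and the signal). All choices may be randomized through the seed. -/
structure Strategy (n : ℕ) (𝒴 𝒳 : Type*) [MeasurableSpace 𝒳] where
  effort : unitInterval → ℝ≥0
  early : unitInterval × History n 𝒴 → Record 𝒴
  late : unitInterval × (ℝ≥0∞ × 𝒳) × History n 𝒴 → Record 𝒴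
  measurable_effort : Measurable effort
  measurable_early : Measurable early
  measurable_late : Measurable late

/-- A strategy for each agent. -/
abbrev Profile (n : ℕ) (𝒴 𝒳 : Type*) [MeasurableSpace 𝒳] := Fin n → Strategy n 𝒴 𝒳

section Play

variable {n : ℕ} {𝒴 𝒳 : Type*}

open scoped Classical in
/-- The time of the latest report in `H` (`0` if there is none). -/
def clock (H : History n 𝒴) : ℝ≥0∞ :=
  Finset.univ.sup fun j => if (H j).1 = ∞ then 0 else (H j).1

open scoped Classical in
/-- The reports of `H` that were sent up to and including time `t`. -/
def upTo (t : ℝ≥0∞) (H : History n 𝒴) : History n 𝒴 :=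
  fun j => if (H j).1 ≤ t then H j else noRecord

open scoped Classical in
/-- The reports of `H` that were sent before time `t`. -/
def before (t : ℝ≥0∞) (H : History n 𝒴) : History n 𝒴 :=
  fun j => if (H j).1 < t then H j else noRecord

variable [MeasurableSpace 𝒳]

open scoped Classical in
/-- The next report of an agent with strategy `s` and private draws `w` after the public history
`H`, if nobody else reports first: he follows the early plan up to the arrival of his signal and
the late plan from then on. He cannot act in the past. -/
def nextReport (s : Strategy n 𝒴 𝒳) (w : Private 𝒳) (H : History n 𝒴) : Record 𝒴 :=
  let e := s.early (w.2.1, H)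
  let l := s.late (w.2.1, (w.2.2, w.1), H)
  if w.2.2 ≤ max e.1 (clock H) then (max l.1 (max w.2.2 (clock H)), l.2)
  else (max e.1 (clock H), e.2)

open scoped Classical in
/-- The agents who are the next to report, send their reports. Each agent reports at most once. -/
def step (σ : Profile n 𝒴 𝒳) (w : Fin n → Private 𝒳) (H : History n 𝒴) : History n 𝒴 :=
  fun i =>
    if (H i).1 = ∞ ∧ (nextReport (σ i) (w i) H).1 < ∞ ∧
        ∀ j, (H j).1 = ∞ → (nextReport (σ i) (w i) H).1 ≤ (nextReport (σ j) (w j) H).1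
    then nextReport (σ i) (w i) H
    else H i

/-- The final record of all reports. Every step before the last report adds at least one report,
so `n` steps are enough. -/
def play (σ : Profile n 𝒴 𝒳) (w : Fin n → Private 𝒳) : History n 𝒴 :=
  (step σ w)^[n] fun _ => noRecord

end Play

section Game

variable {n : ℕ} {𝒴 𝒳 : Type*} [Fintype 𝒴] [MeasurableSpace 𝒴] [MeasurableSpace 𝒳]

/-- The c.d.f. `F_c(t)` of the latency at effort `c ≥ 0`. -/
def cdf (M : Model 𝒴 𝒳) (c t : ℝ) : ℝ :=
  (M.latency c.toNNReal (Iic (ENNReal.ofReal t))).toReal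

/-- The law of the world under the strategy profile `σ`: the outcome follows the prior, given the
outcome the signals are i.i.d., and the latency of each agent depends only on his effort. -/
def law (M : Model 𝒴 𝒳) (σ : Profile n 𝒴 𝒳) : Measure (World n 𝒴 𝒳) :=
  ∑ y, ENNReal.ofReal (M.prior.1 y) • (Measure.dirac y).prod
    (Measure.pi fun i => (M.signal y).toMeasure.prod
      ((volume : Measure unitInterval).compProd
        (M.latency.comap (σ i).effort (σ i).measurable_effort)))

/-- The reward of agent `i` minus his effort. -/
def payoff (M : Model 𝒴 𝒳) (σ : Profile n 𝒴 𝒳) (i : Fin n) (ω : World n 𝒴 𝒳) : ℝ :=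
  reward M.prior M.score M.weight (play σ ω.2) i ω.1 - (σ i).effort (ω.2 i).2.1

/-- The expected utility of agent `i`. -/
def utility (M : Model 𝒴 𝒳) (σ : Profile n 𝒴 𝒳) (i : Fin n) : ℝ :=
  ∫ ω, payoff M σ i ω ∂(law M σ)

/-- The value of the information minus the total effort (the rewards are transfers). -/
def surplus (M : Model 𝒴 𝒳) (σ : Profile n 𝒴 𝒳) (ω : World n 𝒴 𝒳) : ℝ :=
  value M.prior M.score M.weight (play σ ω.2) ω.1 - ∑ i, ((σ i).effort (ω.2 i).2.1 : ℝ)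

/-- The social welfare. -/
def welfare (M : Model 𝒴 𝒳) (σ : Profile n 𝒴 𝒳) : ℝ :=
  ∫ ω, surplus M σ ω ∂(law M σ)

/-- The profile in which agent `i` deviates from `σ` to the strategy `τ`. -/
def deviate (σ : Profile n 𝒴 𝒳) (i : Fin n) (τ : Strategy n 𝒴 𝒳) : Profile n 𝒴 𝒳 :=
  Function.update σ i τ

/-- Nash equilibrium. A deviation is compared only if its payoff is integrable; this is no
restriction when the scoring rule is bounded and the expected effort is finite. -/
def IsNash (M : Model 𝒴 𝒳) (σ : Profile n 𝒴 𝒳) : Prop :=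
  ∀ i, Integrable (payoff M σ i) (law M σ) ∧
    ∀ τ, Integrable (payoff M (deviate σ i τ) i) (law M (deviate σ i τ)) →
      utility M (deviate σ i τ) i ≤ utility M σ i

/-- Every agent has non-negative expected utility in every Nash equilibrium. -/
def IndividuallyRational (n : ℕ) (M : Model 𝒴 𝒳) : Prop :=
  ∀ σ : Profile n 𝒴 𝒳, IsNash M σ → ∀ i, 0 ≤ utility M σ i

open scoped Classical in
/-- What agent `i` has observed up to time `t`: his seed, the arrival time and the value of his
signal if it has arrived, and all reports that have been sent. -/
def view (σ : Profile n 𝒴 𝒳) (i : Fin n) (t : ℝ≥0∞) (ω : World n 𝒴 𝒳) :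
    unitInterval × Option (ℝ≥0∞ × 𝒳) × History n 𝒴 :=
  ((ω.2 i).2.1,
    if (ω.2 i).2.2 ≤ t then some ((ω.2 i).2.2, (ω.2 i).1) else none,
    upTo t (play σ ω.2))

/-- An information set of agent `i` in continuous time, given by the random time `θ` at which it is
reached (`∞` if it is not reached): at any time `t < ∞`, what he has observed tells him whether it
has been reached. -/
def IsInformationTime (σ : Profile n 𝒴 𝒳) (i : Fin n) (θ : World n 𝒴 𝒳 → ℝ≥0∞) : Prop :=
  Measurable θ ∧ ∀ t < ∞, ∀ ω ω', view σ i t ω = view σ i t ω' → (θ ω ≤ t ↔ θ ω' ≤ t)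

/-- Under the law `μ`, the deviation of agent `i` to `τ` almost surely changes neither his effort
nor the market belief at any time. -/
def SamePlay (M : Model 𝒴 𝒳) (μ : Measure (World n 𝒴 𝒳)) (σ : Profile n 𝒴 𝒳) (i : Fin n)
    (τ : Strategy n 𝒴 𝒳) : Prop :=
  (∀ᵐ ω ∂μ, τ.effort (ω.2 i).2.1 = (σ i).effort (ω.2 i).2.1) ∧
  ∀ t > 0, ∀ᵐ ω ∂μ,
    marketBelief M.prior (play (deviate σ i τ) ω.2) t = marketBelief M.prior (play σ ω.2) t

/-- Strict perfect Bayesian equilibrium. At the start, where efforts are chosen, and at every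
information set that is reached with positive probability, no deviation from there on is at least
as good for the agent in expectation given that the information set is reached, unless it changes
neither his effort nor the market belief. -/
def IsStrictPBE (M : Model 𝒴 𝒳) (σ : Profile n 𝒴 𝒳) : Prop :=
  ∀ i, Integrable (payoff M σ i) (law M σ) ∧
    (∀ τ, Integrable (payoff M (deviate σ i τ) i) (law M (deviate σ i τ)) →
      utility M (deviate σ i τ) i ≤ utility M σ i ∧
      (¬ SamePlay M (law M (deviate σ i τ)) σ i τ →
        utility M (deviate σ i τ) i < utility M σ i)) ∧
    (∀ θ, IsInformationTime σ i θ → law M σ {ω | θ ω < ∞} ≠ 0 →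
      ∀ τ : Strategy n 𝒴 𝒳, τ.effort = (σ i).effort →
        (∀ ω, before (θ ω) (play (deviate σ i τ) ω.2) = before (θ ω) (play σ ω.2)) →
        Integrable (payoff M (deviate σ i τ) i) ((law M σ)[|{ω | θ ω < ∞}]) →
        (∫ ω, payoff M (deviate σ i τ) i ω ∂((law M σ)[|{ω | θ ω < ∞}])
          ≤ ∫ ω, payoff M σ i ω ∂((law M σ)[|{ω | θ ω < ∞}])) ∧
        (¬ SamePlay M ((law M σ)[|{ω | θ ω < ∞}]) σ i τ →
          ∫ ω, payoff M (deviate σ i τ) i ω ∂((law M σ)[|{ω | θ ω < ∞}])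
            < ∫ ω, payoff M σ i ω ∂((law M σ)[|{ω | θ ω < ∞}])))

/-- All agents use the same strategy. -/
def IsSymmetric (σ : Profile n 𝒴 𝒳) : Prop :=
  ∀ i j, σ i = σ j

/-- `σ` is symmetric and its social welfare is the largest among all symmetric profiles. As a
proper scoring rule is bounded above, a profile whose surplus is not integrable has welfare `-∞`. -/
def IsSociallyOptimal (M : Model 𝒴 𝒳) (σ : Profile n 𝒴 𝒳) : Prop :=
  IsSymmetric σ ∧ Integrable (surplus M σ) (law M σ) ∧
    ∀ σ' : Profile n 𝒴 𝒳, IsSymmetric σ' → Integrable (surplus M σ') (law M σ') →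
      welfare M σ' ≤ welfare M σ

/-- The likelihoods `P(X = x | Y = y)` of the signal value `x`. Reporting them turns the market
belief into its Bayesian posterior given `x`. -/
def likelihood (M : Model 𝒴 𝒳) (x : 𝒳) : Report 𝒴 :=
  fun y => (M.signal y x).toNNReal

/-- Every report is the likelihood of the reporter's signal. -/
def IsTruthful (M : Model 𝒴 𝒳) (σ : Profile n 𝒴 𝒳) : Prop :=
  ∀ w i, (play σ w i).1 < ∞ → (play σ w i).2 = likelihood M (w i).1

/-- Every agent reports at the moment when his signal arrives. -/
def IsTimely (σ : Profile n 𝒴 𝒳) : Prop :=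
  ∀ w i, (play σ w i).1 = (w i).2.2

/-- The strategy of investing `c` and reporting the likelihood of the signal when it arrives. -/
def truthfulTimely [DiscreteMeasurableSpace 𝒳] [Countable 𝒳] (n : ℕ) (M : Model 𝒴 𝒳) (c : ℝ≥0) :
    Strategy n 𝒴 𝒳 where
  effort _ := c
  early _ := noRecord
  late a := (a.2.1.1, likelihood M a.2.1.2)
  measurable_effort := measurable_const
  measurable_early := measurable_const
  measurable_late :=
    (measurable_fst.comp (measurable_fst.comp measurable_snd)).prodMk
      ((measurable_of_countable (likelihood M)).comp
        (measurable_snd.comp (measurable_fst.comp measurable_snd)))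

/-- Every agent invests the same effort `c`, and `c` maximizes the expected value of information
minus the total effort over the symmetric effort profiles, when all updates are truthful and
timely. -/
def IsEffortOptimal [DiscreteMeasurableSpace 𝒳] [Countable 𝒳] (M : Model 𝒴 𝒳)
    (σ : Profile n 𝒴 𝒳) : Prop :=
  ∃ c : ℝ≥0, (∀ i u, (σ i).effort u = c) ∧
    ∀ c' : ℝ≥0, welfare M (fun _ : Fin n => truthfulTimely n M c')
      ≤ welfare M (fun _ : Fin n => truthfulTimely n M c)

end Game

end MVP

end

/-!
The law of the world makes the Bayesian posterior from the signals that have arrived before time `t`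
the conditional law of the outcome given everything that the agents can know before `t`. The market
belief at `t` is a function of what is known before `t`, whatever the strategies are
(`before_play_congr`), and it equals that posterior if all reports are truthful and timely.
As the scoring rule is proper, truthful and timely reports therefore minimize the expected loss at
every time, on every event that is known before that time, and as it is strictly proper, any other
market belief has a larger expected loss. Beliefs are left-continuous step functions of time, so a
market belief that differs at one time with positive probability differs on a set of times of
positive measure. This gives `lintegral_lossOf_truthful_le`. Losses are measured from the best
possible score, which makes them non-negative, so that they can be integrated without an assumption
on the growth of the scoring rule.

*Reports.* The counterfactual belief for the absence of agent `i` does not depend on what agent `i`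
does when the others report truthfully and in time. So his reward is, up to a term beyond his
control, the negative of the market loss, and with given efforts truthful and timely reports are the
best that he can do, at the start and at every information set.

*Efforts.* With truthful and timely reports the expected value of information at time `t` is
a multilinear symmetric function of the probabilities that the signals have arrived
(`integral_value_truthful`), and the expected reward of agent `i` is his arrival probability times
the partial derivative of this function (`integral_reward_truthful`). On the diagonal all partial
derivatives agree, so that the derivative of the total value along the diagonal is `n` times the
individual one, and the first-order condition for the best common effort is the first-order
condition for the best response of each agent to it (`first_order_condition`). As the arrival
probability is strictly concave in the effort, this best response is unique
(`best_response_unique`).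

*Social optimality.* By propriety, the value of information in any symmetric profile is at most that
of truthful and timely reports with the same efforts. The value is monotone in the arrival
probabilities and these are concave in the effort, so by Jensen's inequality it is at most that of
the mean effort.

*Individual rationality.* An agent who invests nothing and does not report has payoff `0`.
-/

namespace MVP

/-! ### The course of play -/

section Dynamics

variable {n : ℕ} {𝒴 𝒳 : Type*}

lemma clock_le {H : History n 𝒴} {t : ℝ≥0∞} :
    clock H ≤ t ↔ ∀ j, (H j).1 ≠ ∞ → (H j).1 ≤ t := by
  simp only [clock, Finset.sup_le_iff, Finset.mem_univ, true_imp_iff]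
  refine forall_congr' fun j => ?_
  split_ifs with h <;> simp [h]

lemma le_clock {H : History n 𝒴} {j : Fin n} (h : (H j).1 ≠ ∞) : (H j).1 ≤ clock H :=
  clock_le.1 le_rfl j h

variable [MeasurableSpace 𝒳]

lemma clock_le_nextReport (s : Strategy n 𝒴 𝒳) (w : Private 𝒳) (H : History n 𝒴) :
    clock H ≤ (nextReport s w H).1 := by
  simp only [nextReport]
  split_ifs <;> simp

/-- In one step of the recursion an agent either keeps his record, or he had none and now makes his
next report, which is the earliest of all. -/
lemma step_cases (σ : Profile n 𝒴 𝒳) (w : Fin n → Private 𝒳) (H : History n 𝒴) (i : Fin n) :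
    step σ w H i = H i ∨ (step σ w H i = nextReport (σ i) (w i) H ∧ (H i).1 = ∞ ∧
      (nextReport (σ i) (w i) H).1 < ∞ ∧
      ∀ j, (H j).1 = ∞ → (nextReport (σ i) (w i) H).1 ≤ (nextReport (σ j) (w j) H).1) := by
  simp only [step]
  split_ifs with h
  · exact Or.inr ⟨rfl, h⟩
  · exact Or.inl rfl

lemma play_induction {σ : Profile n 𝒴 𝒳} {w : Fin n → Private 𝒳} {P : History n 𝒴 → Prop}
    (h0 : P fun _ => noRecord) (hs : ∀ H, P H → P (step σ w H)) : P (play σ w) := by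
  have : ∀ k, P ((step σ w)^[k] fun _ => noRecord) := by
    intro k
    induction k with
    | zero => exact h0
    | succ k ih => rw [Function.iterate_succ_apply']; exact hs _ ih
  exact this n

/-- An agent who plans no report sends none. -/
lemma play_of_never {σ : Profile n 𝒴 𝒳} {w : Fin n → Private 𝒳} {i : Fin n}
    (h : ∀ H, (nextReport (σ i) (w i) H).1 = ∞) : play σ w i = noRecord := by
  refine play_induction (P := fun H => H i = noRecord) rfl fun H hH => ?_
  rcases step_cases σ w H i with h1 | ⟨_, _, h3, _⟩
  · rw [h1, hH]
  · rw [h H] at h3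
    exact absurd h3 (lt_irrefl _)

/-- The recursion of `play` runs until nobody has a report left to send: each earlier step adds
a report, and there are at most `n`. -/
lemma nextReport_play_eq_top (σ : Profile n 𝒴 𝒳) (w : Fin n → Private 𝒳) (j : Fin n)
    (hj : (play σ w j).1 = ∞) : (nextReport (σ j) (w j) (play σ w)).1 = ∞ := by
  classical
  let stuck : History n 𝒴 → Prop := fun H =>
    ∀ j, (H j).1 = ∞ → (nextReport (σ j) (w j) H).1 = ∞
  let sent : History n 𝒴 → Finset (Fin n) := fun H => Finset.univ.filter fun j => (H j).1 ≠ ∞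
  have key : ∀ k, stuck ((step σ w)^[k] fun _ => noRecord) ∨
      k ≤ (sent ((step σ w)^[k] fun _ => noRecord)).card := by
    intro k
    induction k with
    | zero => right; simp
    | succ k ih =>
      rw [Function.iterate_succ_apply']
      generalize ((step σ w)^[k] fun _ => noRecord) = H at ih
      by_cases hst : stuck H
      · left
        have : step σ w H = H := by
          funext i
          rcases step_cases σ w H i with h1 | ⟨_, h2, h3, _⟩
          · exact h1
          · rw [hst i h2] at h3
            exact absurd h3 (lt_irrefl _)
        rwa [this]
      · right
        have hk := ih.resolve_left hst
        simp only [stuck, not_forall] at hst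
        obtain ⟨j, hj1, hj2⟩ := hst
        obtain ⟨i, hi, hmin⟩ := Finset.exists_min_image
          (Finset.univ.filter fun j => (H j).1 = ∞) (fun j => (nextReport (σ j) (w j) H).1)
          ⟨j, by simp [hj1]⟩
        simp only [Finset.mem_filter, Finset.mem_univ, true_and] at hi hmin
        have hfin : (nextReport (σ i) (w i) H).1 < ∞ :=
          (hmin j hj1).trans_lt (lt_top_iff_ne_top.2 hj2)
        have hsi : step σ w H i = nextReport (σ i) (w i) H := by
          simp only [step]
          rw [if_pos ⟨hi, hfin, hmin⟩]
        refine hk.trans_lt (Finset.card_lt_card ⟨?_, ?_⟩)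
        · intro l hl
          simp only [sent, Finset.mem_filter, Finset.mem_univ, true_and] at hl ⊢
          rcases step_cases σ w H l with h1 | ⟨_, h2, _, _⟩
          · rwa [h1]
          · exact absurd h2 hl
        · intro hsub
          have : i ∈ sent H := hsub (by simp [sent, hsi, hfin.ne])
          simp [sent, hi] at this
  rcases key n with h | h
  · exact h j hj
  · exfalso
    have : (sent ((step σ w)^[n] fun _ => noRecord)).card < n := by
      conv_rhs => rw [← Fintype.card_fin n]
      refine Finset.card_lt_univ_of_notMem (x := j) ?_
      simpa [sent, play] using hj
    omega

/-- The two draws of nature differ only in signals that have not arrived before time `t`. -/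
def AgreeBefore (t : ℝ≥0∞) (w w' : Fin n → Private 𝒳) : Prop :=
  ∀ j, (w j).2 = (w' j).2 ∧ ((w j).2.2 < t → (w j).1 = (w' j).1)

lemma nextReport_eq_or_le {t : ℝ≥0∞} {w w' : Fin n → Private 𝒳} (h : AgreeBefore t w w')
    (σ : Profile n 𝒴 𝒳) (H : History n 𝒴) (j : Fin n) :
    nextReport (σ j) (w j) H = nextReport (σ j) (w' j) H ∨
      (t ≤ (nextReport (σ j) (w j) H).1 ∧ t ≤ (nextReport (σ j) (w' j) H).1) := by
  obtain ⟨h1, h2⟩ := h j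
  rcases lt_or_ge (w j).2.2 t with ht | ht
  · left
    rw [show w j = w' j from Prod.ext (h2 ht) h1]
  · simp only [nextReport, ← h1]
    split_ifs with hc
    · right
      exact ⟨ht.trans (by simp), ht.trans (by simp)⟩
    · exact Or.inl rfl

/-- Causality: what has been reported before time `t` is independent of the signals that have not
arrived before `t`. -/
lemma before_play_congr {t : ℝ≥0∞} {w w' : Fin n → Private 𝒳} (h : AgreeBefore t w w')
    (σ : Profile n 𝒴 𝒳) : before t (play σ w) = before t (play σ w') := by
  let quiet : (Fin n → Private 𝒳) → History n 𝒴 → Prop := fun w H =>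
    ∀ j, (H j).1 = ∞ → t ≤ (nextReport (σ j) (w j) H).1
  have quiet_step : ∀ w H, quiet w H →
      quiet w (step σ w H) ∧ before t (step σ w H) = before t H := by
    intro w H hq
    constructor
    · by_cases hch : step σ w H = H
      · rwa [hch]
      · obtain ⟨i, hi⟩ := Function.ne_iff.1 hch
        obtain ⟨h1, h2, h3, _⟩ := (step_cases σ w H i).resolve_left hi
        intro j _
        refine le_trans ?_ (clock_le_nextReport _ _ _)
        refine (hq i h2).trans ?_
        rw [← h1] at h3 ⊢
        exact le_clock h3.ne
    · funext i
      rcases step_cases σ w H i with h1 | ⟨h1, h2, _, _⟩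
      · simp only [before, h1]
      · simp only [before, h1, h2]
        rw [if_neg (not_lt.2 (hq i h2)), if_neg (by simp)]
  have key : ∀ k, before t ((step σ w)^[k] fun _ => noRecord) =
        before t ((step σ w')^[k] fun _ => noRecord) ∧
      (((step σ w)^[k] fun _ => noRecord) = ((step σ w')^[k] fun _ => noRecord) ∨
        (quiet w ((step σ w)^[k] fun _ => noRecord) ∧
          quiet w' ((step σ w')^[k] fun _ => noRecord))) := by
    intro k
    induction k with
    | zero => exact ⟨rfl, Or.inl rfl⟩
    | succ k ih =>
      rw [Function.iterate_succ_apply', Function.iterate_succ_apply']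
      generalize ((step σ w)^[k] fun _ => noRecord) = H at ih
      generalize ((step σ w')^[k] fun _ => noRecord) = H' at ih
      have hquiet : quiet w H → quiet w' H' → before t (step σ w H) = before t (step σ w' H') ∧
          (step σ w H = step σ w' H' ∨ (quiet w (step σ w H) ∧ quiet w' (step σ w' H'))) := by
        intro q q'
        obtain ⟨a, b⟩ := quiet_step w H q
        obtain ⟨a', b'⟩ := quiet_step w' H' q'
        exact ⟨by rw [b, b', ih.1], Or.inr ⟨a, a'⟩⟩
      rcases ih.2 with heq | ⟨q, q'⟩
      · subst heq
        by_cases q : quiet w H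
        · refine hquiet q fun j hj => ?_
          rcases nextReport_eq_or_le h σ H j with h1 | h1
          · rw [← h1]; exact q j hj
          · exact h1.2
        · simp only [quiet, not_forall, not_le] at q
          obtain ⟨j₀, hj₀, hlt⟩ := q
          have hN₀ : nextReport (σ j₀) (w j₀) H = nextReport (σ j₀) (w' j₀) H :=
            (nextReport_eq_or_le h σ H j₀).resolve_right fun h1 => not_le.2 hlt h1.1
          have : step σ w H = step σ w' H := by
            funext i
            rcases nextReport_eq_or_le h σ H i with hi | hi
            · simp only [step, ← hi]
              congr 1
              refine propext (and_congr_right fun _ => and_congr_right fun _ => ?_)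
              constructor
              · intro hm j hj
                rcases nextReport_eq_or_le h σ H j with h1 | h1
                · rw [← h1]; exact hm j hj
                · exact ((hm j₀ hj₀).trans_lt hlt).le.trans h1.2
              · intro hm j hj
                rcases nextReport_eq_or_le h σ H j with h1 | h1
                · rw [h1]; exact hm j hj
                · exact ((hm j₀ hj₀).trans_lt (hN₀ ▸ hlt)).le.trans h1.1
            · simp only [step]
              rw [if_neg, if_neg]
              · exact fun hc => not_le.2 (hN₀ ▸ hlt) (hi.2.trans (hc.2.2 j₀ hj₀))
              · exact fun hc => not_le.2 hlt (hi.1.trans (hc.2.2 j₀ hj₀))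
          rw [this]
          exact ⟨rfl, Or.inl rfl⟩
      · exact hquiet q q'
  exact (key n).1

end Dynamics

section TruthfulTimely

variable {n : ℕ} {𝒴 𝒳 : Type*} [Fintype 𝒴]
  [MeasurableSpace 𝒳] [DiscreteMeasurableSpace 𝒳] [Countable 𝒳]

lemma nextReport_truthfulTimely (M : Model 𝒴 𝒳) (c : ℝ≥0) (w : Private 𝒳) (H : History n 𝒴) :
    nextReport (truthfulTimely n M c) w H = (max w.2.2 (clock H), likelihood M w.1) := by
  simp [nextReport, truthfulTimely, noRecord]

open scoped Classical in
/-- A truthful and timely agent reports the likelihoods of his signal when it arrives, whatever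
the other agents do. -/
lemma play_truthfulTimely (M : Model 𝒴 𝒳) {c : ℝ≥0} {σ : Profile n 𝒴 𝒳} {i : Fin n}
    (hi : σ i = truthfulTimely n M c) (w : Fin n → Private 𝒳) :
    play σ w i = if (w i).2.2 < ∞ then ((w i).2.2, likelihood M (w i).1) else noRecord := by
  have inv : (play σ w i = noRecord ∧ clock (play σ w) ≤ (w i).2.2) ∨
      ((w i).2.2 < ∞ ∧ play σ w i = ((w i).2.2, likelihood M (w i).1)) := by
    refine play_induction (P := fun H => (H i = noRecord ∧ clock H ≤ (w i).2.2) ∨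
      ((w i).2.2 < ∞ ∧ H i = ((w i).2.2, likelihood M (w i).1))) ?_ fun H hH => ?_
    · left
      refine ⟨rfl, clock_le.2 fun j hj => ?_⟩
      exact absurd rfl hj
    · rcases hH with ⟨h1, h2⟩ | ⟨h1, h2⟩
      · have hN : nextReport (σ i) (w i) H = ((w i).2.2, likelihood M (w i).1) := by
          rw [hi, nextReport_truthfulTimely, max_eq_left h2]
        rcases step_cases σ w H i with h3 | ⟨h3, _, h4, _⟩
        · left
          refine ⟨h3.trans h1, clock_le.2 fun j hj => ?_⟩
          rcases step_cases σ w H j with h5 | ⟨h5, _, _, h6⟩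
          · rw [h5] at hj ⊢
            exact (le_clock hj).trans h2
          · rw [h5]
            refine (h6 i (by rw [h1]; rfl)).trans ?_
            rw [hN]
        · right
          rw [hN] at h3 h4
          exact ⟨h4, h3⟩
      · right
        refine ⟨h1, ?_⟩
        rcases step_cases σ w H i with h3 | ⟨_, h4, _⟩
        · exact h3.trans h2
        · rw [h2] at h4
          exact absurd h4 h1.ne
  rcases inv with ⟨h1, h2⟩ | ⟨h1, h2⟩
  · have := nextReport_play_eq_top σ w i (by rw [h1]; rfl)
    rw [hi, nextReport_truthfulTimely, max_eq_left h2] at this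
    rw [if_neg (by simp only at this; rw [this]; exact lt_irrefl _), h1]
  · rw [if_pos h1, h2]

end TruthfulTimely

/-! ### Beliefs -/

section Beliefs

variable {n : ℕ} {𝒴 𝒳 : Type*} [Fintype 𝒴]

open scoped Classical in
lemma beliefFrom_eq (p : stdSimplex ℝ 𝒴) (H : History n 𝒴) (K : Finset (Fin n)) (t : ℝ) :
    beliefFrom p H K t =
      bayesUpdate p (∏ j ∈ K, if (H j).1 < ENNReal.ofReal t then (H j).2 else 1) := by
  rw [beliefFrom, Finset.prod_filter]

lemma marketBelief_congr (p : stdSimplex ℝ 𝒴) {H H' : History n 𝒴} {t : ℝ}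
    (h : before (ENNReal.ofReal t) H = before (ENNReal.ofReal t) H') :
    marketBelief p H t = marketBelief p H' t := by
  classical
  simp only [marketBelief, beliefFrom_eq]
  congr 1
  refine Finset.prod_congr rfl fun j _ => ?_
  have := congrArg Prod.snd (congrFun h j)
  simp only [before] at this
  split_ifs at this ⊢ <;> first | rfl | simpa [noRecord] using this

/-- A report affects the belief only after it has been sent, so beliefs are left-continuous step
functions of time. -/
lemma eventually_marketBelief_eq (p : stdSimplex ℝ 𝒴) (H : History n 𝒴) (t : ℝ) :
    ∀ᶠ r in nhdsWithin t (Iio t), marketBelief p H r = marketBelief p H t := by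
  classical
  have h : ∀ᶠ r in nhdsWithin t (Iio t), ∀ j : Fin n,
      (H j).1 < ENNReal.ofReal r ↔ (H j).1 < ENNReal.ofReal t := by
    refine Filter.eventually_all.2 fun j => ?_
    by_cases hj : (H j).1 < ENNReal.ofReal t
    · have := (ENNReal.continuous_ofReal.tendsto t).eventually (lt_mem_nhds hj)
      filter_upwards [nhdsWithin_le_nhds this] with r hr
      simp [hr, hj]
    · filter_upwards [self_mem_nhdsWithin] with r hr
      simp only [hj, iff_false, not_lt]
      exact (ENNReal.ofReal_le_ofReal (le_of_lt hr)).trans (not_lt.1 hj)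
  filter_upwards [h] with r hr
  simp only [marketBelief, beliefFrom_eq, hr]

/-- The Bayesian posterior of the outcome given the signals of the agents in `A`. -/
noncomputable def posterior (M : Model 𝒴 𝒳) (A : Finset (Fin n)) (x : Fin n → 𝒳) :
    stdSimplex ℝ 𝒴 :=
  bayesUpdate M.prior (∏ j ∈ A, likelihood M (x j))

open scoped Classical in
/-- The agents whose signals arrive before time `t`, given all seeds and arrival times. -/
noncomputable def arrived (t : ℝ) (b : Fin n → unitInterval × ℝ≥0∞) : Finset (Fin n) :=
  Finset.univ.filter fun j => (b j).2 < ENNReal.ofReal t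

lemma mem_arrived {t : ℝ} {b : Fin n → unitInterval × ℝ≥0∞} {j : Fin n} :
    j ∈ arrived t b ↔ (b j).2 < ENNReal.ofReal t := by
  simp [arrived]

/-- The signals in a draw of nature. -/
abbrev signals (w : Fin n → Private 𝒳) : Fin n → 𝒳 := fun j => (w j).1

/-- The seeds and arrival times in a draw of nature. -/
abbrev arrivals (w : Fin n → Private 𝒳) : Fin n → unitInterval × ℝ≥0∞ := fun j => (w j).2

section Truthful

variable [MeasurableSpace 𝒳] [DiscreteMeasurableSpace 𝒳] [Countable 𝒳]

lemma beliefFrom_truthful (M : Model 𝒴 𝒳) {σ : Profile n 𝒴 𝒳} {c : ℝ≥0} {K : Finset (Fin n)}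
    (hK : ∀ j ∈ K, σ j = truthfulTimely n M c) (w : Fin n → Private 𝒳) (t : ℝ) :
    beliefFrom M.prior (play σ w) K t =
      posterior M (K ∩ arrived t (arrivals w)) (signals w) := by
  classical
  rw [beliefFrom_eq, posterior, ← Finset.filter_mem_eq_inter, Finset.prod_filter]
  congr 1
  refine Finset.prod_congr rfl fun j hj => ?_
  simp only [play_truthfulTimely M (hK j hj), mem_arrived]
  by_cases h : (w j).2.2 < ∞
  · simp only [h, if_true]
  · have h1 : (w j).2.2 = ∞ := by simpa using h
    simp [h1, noRecord]

/-- If all agents are truthful and timely, then the market belief is the posterior given the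
signals that have arrived. -/
lemma marketBelief_truthful (M : Model 𝒴 𝒳) (c : ℝ≥0) (w : Fin n → Private 𝒳) (t : ℝ) :
    marketBelief M.prior (play (fun _ => truthfulTimely n M c) w) t =
      posterior M (arrived t (arrivals w)) (signals w) := by
  rw [marketBelief, beliefFrom_truthful M (fun _ _ => rfl), Finset.univ_inter]

lemma counterfactualBelief_deviate (M : Model 𝒴 𝒳) (c : ℝ≥0) (i : Fin n) (τ : Strategy n 𝒴 𝒳)
    (w : Fin n → Private 𝒳) (t : ℝ) :
    counterfactualBelief M.prior (play (deviate (fun _ => truthfulTimely n M c) i τ) w) i t =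
      posterior M ((arrived t (arrivals w)).erase i) (signals w) := by
  rw [counterfactualBelief, beliefFrom_truthful M (c := c), Finset.erase_inter, Finset.univ_inter]
  intro j hj
  exact Function.update_of_ne (Finset.ne_of_mem_erase hj) _ _

lemma counterfactualBelief_truthful (M : Model 𝒴 𝒳) (c : ℝ≥0) (i : Fin n)
    (w : Fin n → Private 𝒳) (t : ℝ) :
    counterfactualBelief M.prior (play (fun _ => truthfulTimely n M c) w) i t =
      posterior M ((arrived t (arrivals w)).erase i) (signals w) := by
  rw [counterfactualBelief, beliefFrom_truthful M (fun _ _ => rfl), Finset.erase_inter,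
    Finset.univ_inter]

end Truthful

end Beliefs

/-! ### Measurability of the play -/

section Measurability

variable {n : ℕ} {𝒴 𝒳 : Type*}

lemma measurable_bayesUpdate [Fintype 𝒴] (p : stdSimplex ℝ 𝒴) : Measurable (bayesUpdate p) := by
  classical
  have h : Measurable fun b : Report 𝒴 => (bayesUpdate p b).1 := by
    have : (fun b : Report 𝒴 => (bayesUpdate p b).1) = fun b =>
        if ∑ z, p.1 z * (b z : ℝ) = 0 then p.1 else
          fun y => p.1 y * b y / ∑ z, p.1 z * (b z : ℝ) := by
      funext b
      simp only [bayesUpdate]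
      split_ifs <;> rfl
    rw [this]
    have hZ : Measurable fun b : Report 𝒴 => ∑ z, p.1 z * (b z : ℝ) := by fun_prop
    refine Measurable.ite (hZ (measurableSet_singleton 0)) measurable_const ?_
    exact measurable_pi_lambda _ fun y => by fun_prop
  exact h.subtype_mk (h := fun b => (bayesUpdate p b).2)

lemma measurable_clock : Measurable (clock : History n 𝒴 → ℝ≥0∞) := by
  classical
  have : (clock : History n 𝒴 → ℝ≥0∞) =
      fun H => ⨆ j, if (H j).1 = ∞ then 0 else (H j).1 := by
    funext H
    simp only [clock, Finset.sup_univ_eq_iSup]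
  rw [this]
  refine Measurable.iSup fun j => ?_
  exact Measurable.ite ((by fun_prop : Measurable fun H : History n 𝒴 => (H j).1)
    (measurableSet_singleton ∞)) measurable_const (by fun_prop)

variable [MeasurableSpace 𝒳]

lemma measurable_nextReport (s : Strategy n 𝒴 𝒳) :
    Measurable fun a : Private 𝒳 × History n 𝒴 => nextReport s a.1 a.2 := by
  classical
  have he : Measurable fun a : Private 𝒳 × History n 𝒴 => s.early (a.1.2.1, a.2) :=
    s.measurable_early.comp (by fun_prop)
  have hl : Measurable fun a : Private 𝒳 × History n 𝒴 =>
      s.late (a.1.2.1, (a.1.2.2, a.1.1), a.2) :=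
    s.measurable_late.comp (by fun_prop)
  have hc : Measurable fun a : Private 𝒳 × History n 𝒴 => clock a.2 :=
    measurable_clock.comp measurable_snd
  have hT : Measurable fun a : Private 𝒳 × History n 𝒴 => a.1.2.2 := by fun_prop
  simp only [nextReport]
  refine Measurable.ite (measurableSet_le hT (he.fst.max hc)) ?_ ?_
  · exact (hl.fst.max (hT.max hc)).prodMk hl.snd
  · exact (he.fst.max hc).prodMk he.snd

lemma measurable_step (σ : Profile n 𝒴 𝒳) :
    Measurable fun a : (Fin n → Private 𝒳) × History n 𝒴 => step σ a.1 a.2 := by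
  classical
  have hN : ∀ i, Measurable fun a : (Fin n → Private 𝒳) × History n 𝒴 =>
      nextReport (σ i) (a.1 i) a.2 := fun i =>
    (measurable_nextReport (σ i)).comp
      (g := fun a : Private 𝒳 × History n 𝒴 => nextReport (σ i) a.1 a.2)
      (f := fun a : (Fin n → Private 𝒳) × History n 𝒴 => (a.1 i, a.2))
      (((measurable_pi_apply i).comp measurable_fst).prodMk measurable_snd)
  have hH : ∀ i, Measurable fun a : (Fin n → Private 𝒳) × History n 𝒴 => a.2 i := fun i => by
    fun_prop
  refine measurable_pi_lambda _ fun i => ?_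
  simp only [step]
  refine Measurable.ite ?_ (hN i) (hH i)
  refine ((hH i).fst (measurableSet_singleton ∞)).inter (MeasurableSet.inter ?_ ?_)
  · exact measurableSet_lt (hN i).fst measurable_const
  · have : {a : (Fin n → Private 𝒳) × History n 𝒴 | ∀ j, (a.2 j).1 = ∞ →
        (nextReport (σ i) (a.1 i) a.2).1 ≤ (nextReport (σ j) (a.1 j) a.2).1} =
        ⋂ j, ({a | (a.2 j).1 = ∞}ᶜ ∪
          {a | (nextReport (σ i) (a.1 i) a.2).1 ≤ (nextReport (σ j) (a.1 j) a.2).1}) := by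
      ext a
      simp [imp_iff_not_or]
    refine MeasurableSet.congr ?_ this.symm
    exact MeasurableSet.iInter fun j =>
      ((hH j).fst (measurableSet_singleton ∞)).compl.union (measurableSet_le (hN i).fst (hN j).fst)

lemma measurable_play (σ : Profile n 𝒴 𝒳) : Measurable (play σ) := by
  have : ∀ k, Measurable fun w => (step σ w)^[k] fun _ => noRecord := by
    intro k
    induction k with
    | zero => exact measurable_const
    | succ k ih =>
      simp only [Function.iterate_succ_apply']
      exact (measurable_step σ).comp (measurable_id.prodMk ih)
  exact this n

lemma measurable_beliefFrom [Fintype 𝒴] (p : stdSimplex ℝ 𝒴) (K : Finset (Fin n)) :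
    Measurable fun a : History n 𝒴 × ℝ => beliefFrom p a.1 K a.2 := by
  classical
  simp only [beliefFrom_eq]
  have h : Measurable fun a : History n 𝒴 × ℝ =>
      ∏ j ∈ K, if (a.1 j).1 < ENNReal.ofReal a.2 then (a.1 j).2 else 1 := by
    refine measurable_pi_lambda _ fun y => ?_
    simp only [Finset.prod_apply]
    refine Finset.measurable_fun_prod _ fun j _ => ?_
    have hj : Measurable fun a : History n 𝒴 × ℝ => a.1 j :=
      (measurable_pi_apply j).comp measurable_fst
    simp only [ite_apply, Pi.one_apply]
    exact Measurable.ite (measurableSet_lt hj.fst measurable_snd.ennreal_ofReal)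
      ((measurable_pi_apply y).comp hj.snd) measurable_const
  exact (measurable_bayesUpdate p).comp h

lemma measurable_marketBelief_play [Fintype 𝒴] (p : stdSimplex ℝ 𝒴) (σ : Profile n 𝒴 𝒳) :
    Measurable fun a : ℝ × (Fin n → Private 𝒳) => marketBelief p (play σ a.2) a.1 :=
  (measurable_beliefFrom p Finset.univ).comp
    (g := fun a : History n 𝒴 × ℝ => beliefFrom p a.1 Finset.univ a.2)
    (f := fun a : ℝ × (Fin n → Private 𝒳) => (play σ a.2, a.1))
    (((measurable_play σ).comp measurable_snd).prodMk measurable_fst)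

lemma measurableSet_arrived_eq (A : Finset (Fin n)) :
    MeasurableSet {a : ℝ × (Fin n → unitInterval × ℝ≥0∞) | arrived a.1 a.2 = A} := by
  classical
  have : {a : ℝ × (Fin n → unitInterval × ℝ≥0∞) | arrived a.1 a.2 = A} =
      ⋂ j, {a | (a.2 j).2 < ENNReal.ofReal a.1 ↔ j ∈ A} := by
    ext a
    simp [Finset.ext_iff, mem_arrived]
  rw [this]
  refine MeasurableSet.iInter fun j => ?_
  have h : MeasurableSet {a : ℝ × (Fin n → unitInterval × ℝ≥0∞) |
      (a.2 j).2 < ENNReal.ofReal a.1} :=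
    measurableSet_lt (by fun_prop) (by fun_prop)
  by_cases hj : j ∈ A
  · simpa only [hj, iff_true] using h
  · simp only [hj, iff_false]
    exact h.compl

/-- As a function into the finite discrete space of sets of agents, `arrived` is measurable, so it
can be composed with any function. -/
lemma measurable_comp_arrived {β : Type*} [MeasurableSpace β] (f : Finset (Fin n) → β) :
    Measurable fun a : ℝ × (Fin n → unitInterval × ℝ≥0∞) => f (arrived a.1 a.2) := by
  let _ : MeasurableSpace (Finset (Fin n)) := ⊤
  have : Measurable fun a : ℝ × (Fin n → unitInterval × ℝ≥0∞) => arrived a.1 a.2 :=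
    measurable_to_countable' fun A => measurableSet_arrived_eq A
  exact (measurable_from_top (f := f)).comp this

end Measurability

/-! ### The joint law of the outcome, the signals and the arrival times -/

section JointLaw

variable {n : ℕ} {𝒴 𝒳 : Type*} [Fintype 𝒴]

/-- The probability that `Y = y` and that the signals are `x`. -/
noncomputable def jointProb (M : Model 𝒴 𝒳) (y : 𝒴) (x : Fin n → 𝒳) : ℝ :=
  M.prior.1 y * ∏ j, (M.signal y (x j)).toReal

lemma jointProb_nonneg (M : Model 𝒴 𝒳) (y : 𝒴) (x : Fin n → 𝒳) : 0 ≤ jointProb M y x :=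
  mul_nonneg (M.prior.2.1 y) (Finset.prod_nonneg fun _ _ => ENNReal.toReal_nonneg)

lemma posterior_mul_eq (M : Model 𝒴 𝒳) (A : Finset (Fin n)) (x : Fin n → 𝒳) (y : 𝒴) :
    (∑ z, M.prior.1 z * ∏ j ∈ A, (M.signal z (x j)).toReal) * (posterior M A x).1 y =
      M.prior.1 y * ∏ j ∈ A, (M.signal y (x j)).toReal := by
  have hlik : ∀ z, (((∏ j ∈ A, likelihood M (x j)) z : ℝ≥0) : ℝ) =
      ∏ j ∈ A, (M.signal z (x j)).toReal := fun z => by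
    rw [Finset.prod_apply, NNReal.coe_prod]
    rfl
  simp only [posterior, bayesUpdate, hlik]
  split_ifs with h
  · have h0 := (Finset.sum_eq_zero_iff_of_nonneg fun z _ => mul_nonneg (M.prior.2.1 z)
      (Finset.prod_nonneg fun j _ => ENNReal.toReal_nonneg)).1 h y (Finset.mem_univ y)
    rw [h, zero_mul]
    exact h0.symm
  · field_simp

/-- The draws of nature with given signals, seeds and arrival times. -/
abbrev merge (x : Fin n → 𝒳) (b : Fin n → unitInterval × ℝ≥0∞) : Fin n → Private 𝒳 :=
  fun j => (x j, b j)

lemma measurable_merge [MeasurableSpace 𝒳] (x : Fin n → 𝒳) : Measurable (merge x) :=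
  measurable_pi_lambda _ fun j => measurable_const.prodMk (measurable_pi_apply j)

variable [Fintype 𝒳]

lemma sum_signal_toReal (M : Model 𝒴 𝒳) (y : 𝒴) : ∑ a, (M.signal y a).toReal = 1 := by
  rw [← ENNReal.toReal_sum fun a _ => PMF.apply_ne_top _ a]
  have := (M.signal y).tsum_coe
  rw [tsum_fintype] at this
  simp [this]

lemma sum_jointProb (M : Model 𝒴 𝒳) : ∑ y, ∑ x : Fin n → 𝒳, jointProb M y x = 1 := by
  classical
  simp only [jointProb, ← Finset.mul_sum]
  have : ∀ y, ∑ x : Fin n → 𝒳, ∏ j, (M.signal y (x j)).toReal = 1 := fun y => by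
    rw [← Fintype.prod_sum fun (_ : Fin n) a => (M.signal y a).toReal]
    simp [sum_signal_toReal]
  simp [this, M.prior.2.2]

lemma sum_ofReal_jointProb (M : Model 𝒴 𝒳) :
    ∑ y, ∑ x : Fin n → 𝒳, ENNReal.ofReal (jointProb M y x) = 1 := by
  rw [← ENNReal.ofReal_one, ← sum_jointProb (n := n) M,
    ENNReal.ofReal_sum_of_nonneg fun y _ => Finset.sum_nonneg fun x _ => jointProb_nonneg M y x]
  exact Finset.sum_congr rfl fun y _ =>
    (ENNReal.ofReal_sum_of_nonneg fun x _ => jointProb_nonneg M y x).symm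

/-- A marginalization: the expectation of a function of the coordinates in `A` is a sum with
weights that involve the probabilities of these coordinates only, and a factor that is the same
for all probability vectors `p`. -/
lemma exists_sum_prod_mul_eq [Nonempty 𝒳] (A : Finset (Fin n)) :
    ∃ N : (Fin n → 𝒳) → ℝ, ∀ p : 𝒳 → ℝ, ∑ a, p a = 1 → ∀ g : (Fin n → 𝒳) → ℝ,
      (∀ x x', (∀ j ∈ A, x j = x' j) → g x = g x') →
      ∑ x, (∏ j, p (x j)) * g x = ∑ x, N x * (∏ j ∈ A, p (x j)) * g x := by
  classical
  obtain ⟨a₀⟩ := ‹Nonempty 𝒳›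
  refine ⟨fun x => ∏ j, if j ∈ A then 1 else if a₀ = x j then 1 else 0, fun p hp g hg => ?_⟩
  let r : (Fin n → 𝒳) → (Fin n → 𝒳) := fun x j => if j ∈ A then x j else a₀
  have hr : ∀ x, g x = g (r x) := fun x => hg _ _ fun j hj => by simp [r, hj]
  have h1 : ∑ x, (∏ j, p (x j)) * g x =
      ∑ z : Fin n → 𝒳, ∑ x : Fin n → 𝒳, (∏ j, p (x j) * if (if j ∈ A then x j else a₀) = z j then 1 else 0) * g z := by
    rw [Finset.sum_comm]
    refine Finset.sum_congr rfl fun x _ => ?_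
    rw [Finset.sum_eq_single (r x)]
    · rw [← hr]
      congr 1
      exact Finset.prod_congr rfl fun j _ => by simp [r]
    · intro z _ hz
      obtain ⟨j, hj⟩ := Function.ne_iff.1 hz
      rw [Finset.prod_eq_zero (Finset.mem_univ j), zero_mul]
      rw [if_neg fun h => hj h.symm, mul_zero]
    · simp
  rw [h1]
  refine Finset.sum_congr rfl fun z _ => ?_
  rw [← Finset.sum_mul]
  congr 1
  rw [← Fintype.prod_sum fun (j : Fin n) a =>
    p a * if (if j ∈ A then a else a₀) = z j then 1 else 0]
  rw [← Fintype.prod_ite_mem A fun j => p (z j), ← Finset.prod_mul_distrib]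
  refine Finset.prod_congr rfl fun j _ => ?_
  by_cases hj : j ∈ A
  · simp [hj]
  · simp only [hj, if_false, mul_one]
    rw [← Finset.sum_mul, hp, one_mul]

/-- The posterior is the conditional law of the outcome: for a function of the outcome and the
signals of `A`, the outcome can be replaced by an average over the posterior given these signals. -/
lemma sum_jointProb_mul_eq (M : Model 𝒴 𝒳) (A : Finset (Fin n)) (f : 𝒴 → (Fin n → 𝒳) → ℝ)
    (hf : ∀ y x x', (∀ j ∈ A, x j = x' j) → f y x = f y x') :
    ∑ y, ∑ x, jointProb M y x * f y x =
      ∑ y, ∑ x, jointProb M y x * ∑ z, (posterior M A x).1 z * f z x := by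
  have : Nonempty 𝒴 := by
    by_contra h
    rw [not_nonempty_iff] at h
    simpa using M.prior.2.2
  have : Nonempty 𝒳 := (M.signal (Classical.arbitrary 𝒴)).support_nonempty.nonempty
  obtain ⟨N, hN⟩ := exists_sum_prod_mul_eq (n := n) (𝒳 := 𝒳) A
  have key : ∀ f : 𝒴 → (Fin n → 𝒳) → ℝ, (∀ y x x', (∀ j ∈ A, x j = x' j) → f y x = f y x') →
      ∑ y, ∑ x, jointProb M y x * f y x =
        ∑ x, N x * ∑ y, (M.prior.1 y * ∏ j ∈ A, (M.signal y (x j)).toReal) * f y x := by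
    intro f hf
    simp only [Finset.mul_sum]
    rw [Finset.sum_comm (s := Finset.univ (α := Fin n → 𝒳))]
    refine Finset.sum_congr rfl fun y _ => ?_
    have := congrArg (M.prior.1 y * ·)
      (hN (fun a => (M.signal y a).toReal) (sum_signal_toReal M y) (f y) (hf y))
    simp only [Finset.mul_sum] at this
    simp only [jointProb]
    convert this using 2 <;> ring
  have hpost : ∀ x x', (∀ j ∈ A, x j = x' j) → posterior M A x = posterior M A x' := by
    intro x x' h
    rw [posterior, posterior, Finset.prod_congr rfl fun j hj => by rw [h j hj]]
  rw [key f hf, key (fun _ x => ∑ z, (posterior M A x).1 z * f z x)]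
  · refine Finset.sum_congr rfl fun x _ => ?_
    rw [← Finset.sum_mul, Finset.mul_sum (f := fun z => (posterior M A x).1 z * f z x)]
    simp only [← mul_assoc, posterior_mul_eq]
  · intro y x x' h
    simp only [hpost x x' h]
    exact Finset.sum_congr rfl fun z _ => by rw [hf z x x' h]

variable [MeasurableSpace 𝒴] [MeasurableSpace 𝒳]

/-- The law of the seeds and arrival times of all agents. It is independent of the outcome and
the signals. -/
noncomputable def arrivalLaw (M : Model 𝒴 𝒳) (σ : Profile n 𝒴 𝒳) :
    Measure (Fin n → unitInterval × ℝ≥0∞) :=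
  Measure.pi fun i => (volume : Measure unitInterval).compProd
    (M.latency.comap (σ i).effort (σ i).measurable_effort)

instance (M : Model 𝒴 𝒳) [IsMarkovKernel M.latency] (σ : Profile n 𝒴 𝒳) :
    IsProbabilityMeasure (arrivalLaw M σ) := by
  unfold arrivalLaw; infer_instance

variable [DiscreteMeasurableSpace 𝒳]

/-- The law of the world is a finite mixture, over the outcome and the signals, of copies of the
law of the seeds and arrival times. -/
lemma law_eq (M : Model 𝒴 𝒳) [IsMarkovKernel M.latency] (σ : Profile n 𝒴 𝒳) :
    law M σ = ∑ y, ∑ x : Fin n → 𝒳, ENNReal.ofReal (jointProb M y x) •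
      (arrivalLaw M σ).map fun b => (y, merge x b) := by
  refine Measure.ext_of_lintegral _ fun f hf => ?_
  rw [law, lintegral_finsetSum_measure, lintegral_finsetSum_measure]
  refine Finset.sum_congr rfl fun y _ => ?_
  rw [lintegral_finsetSum_measure, lintegral_smul_measure, lintegral_prod _ hf.aemeasurable,
    lintegral_dirac']
  swap
  · exact hf.lintegral_prod_right'
  have hfy : Measurable fun w : Fin n → Private 𝒳 => f (y, w) := hf.comp (by fun_prop)
  have hmp := (measurePreserving_arrowProdEquivProdArrow 𝒳 (unitInterval × ℝ≥0∞) (Fin n)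
    (fun _ => (M.signal y).toMeasure) fun i => (volume : Measure unitInterval).compProd
      (M.latency.comap (σ i).effort (σ i).measurable_effort)).symm
  rw [← hmp.lintegral_comp hfy, lintegral_prod (fun a => f (y, (MeasurableEquiv.arrowProdEquivProdArrow 𝒳
    (unitInterval × ℝ≥0∞) (Fin n)).symm a)) (hfy.comp hmp.measurable).aemeasurable,
    lintegral_fintype, smul_eq_mul, Finset.mul_sum]
  refine Finset.sum_congr rfl fun x _ => ?_
  have hmx : Measurable fun b => (y, merge x b) := measurable_const.prodMk (measurable_merge x)
  rw [lintegral_smul_measure, lintegral_map hf hmx, smul_eq_mul, jointProb,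
    ENNReal.ofReal_mul (M.prior.2.1 y), ENNReal.ofReal_prod_of_nonneg
      fun _ _ => ENNReal.toReal_nonneg, mul_assoc, mul_comm (∏ _, _)]
  congr 2
  rw [← Set.univ_pi_singleton, Measure.pi_pi]
  refine Finset.prod_congr rfl fun j _ => ?_
  rw [PMF.toMeasure_apply_singleton _ _ (measurableSet_singleton _),
    ENNReal.ofReal_toReal (PMF.apply_ne_top _ _)]

instance (M : Model 𝒴 𝒳) [IsMarkovKernel M.latency] (σ : Profile n 𝒴 𝒳) :
    IsProbabilityMeasure (law M σ) := by
  constructor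
  rw [law_eq]
  simp only [Measure.coe_finsetSum, Finset.sum_apply, Measure.smul_apply, smul_eq_mul]
  have : ∀ (y : 𝒴) (x : Fin n → 𝒳),
      (arrivalLaw M σ).map (fun b => (y, merge x b)) univ = 1 := fun y x => by
    rw [Measure.map_apply (measurable_const.prodMk (measurable_merge x)) MeasurableSet.univ]
    simp
  simp only [this, mul_one, sum_ofReal_jointProb]

lemma lintegral_law (M : Model 𝒴 𝒳) [IsMarkovKernel M.latency] (σ : Profile n 𝒴 𝒳)
    {f : World n 𝒴 𝒳 → ℝ≥0∞} (hf : Measurable f) :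
    ∫⁻ ω, f ω ∂law M σ = ∫⁻ b, ∑ y, ∑ x : Fin n → 𝒳,
      ENNReal.ofReal (jointProb M y x) * f (y, merge x b) ∂arrivalLaw M σ := by
  have hm : ∀ (y : 𝒴) (x : Fin n → 𝒳), Measurable fun b => f (y, merge x b) := fun y x =>
    hf.comp (measurable_const.prodMk (measurable_merge x))
  rw [law_eq, lintegral_finsetSum_measure, lintegral_finsetSum _ fun y _ =>
    Finset.measurable_fun_sum _ fun x _ => (hm y x).const_mul _]
  refine Finset.sum_congr rfl fun y _ => ?_
  rw [lintegral_finsetSum_measure, lintegral_finsetSum _ fun x _ => (hm y x).const_mul _]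
  refine Finset.sum_congr rfl fun x _ => ?_
  rw [lintegral_smul_measure, lintegral_map hf (measurable_const.prodMk (measurable_merge x)),
    lintegral_const_mul _ (hm y x), smul_eq_mul]

lemma integral_law (M : Model 𝒴 𝒳) [IsMarkovKernel M.latency] (σ : Profile n 𝒴 𝒳)
    {f : World n 𝒴 𝒳 → ℝ} (hf : Measurable f) {C : ℝ} (hC : ∀ ω, |f ω| ≤ C) :
    ∫ ω, f ω ∂law M σ = ∫ b, ∑ y, ∑ x : Fin n → 𝒳,
      jointProb M y x * f (y, merge x b) ∂arrivalLaw M σ := by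
  have hm : ∀ (y : 𝒴) (x : Fin n → 𝒳), Measurable fun b => (y, merge x b) := fun y x =>
    measurable_const.prodMk (measurable_merge x)
  have hint : ∀ (y : 𝒴) (x : Fin n → 𝒳),
      Integrable (fun b => f (y, merge x b)) (arrivalLaw M σ) := fun y x =>
    Integrable.of_bound (hf.comp (hm y x)).aestronglyMeasurable C (.of_forall fun b => hC _)
  have hint' : ∀ (y : 𝒴) (x : Fin n → 𝒳), Integrable f (ENNReal.ofReal (jointProb M y x) •
      (arrivalLaw M σ).map fun b => (y, merge x b)) := fun y x =>
    Integrable.smul_measure ((integrable_map_measure hf.aestronglyMeasurable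
      (hm y x).aemeasurable).2 (hint y x)) ENNReal.ofReal_ne_top
  rw [law_eq, integral_finsetSum_measure fun y _ => integrable_finsetSum_measure.2 fun x _ =>
      hint' y x, integral_finsetSum _ fun y _ =>
    integrable_finsetSum _ fun x _ => (hint y x).const_mul _]
  refine Finset.sum_congr rfl fun y _ => ?_
  rw [integral_finsetSum_measure fun x _ => hint' y x,
    integral_finsetSum _ fun x _ => (hint y x).const_mul _]
  refine Finset.sum_congr rfl fun x _ => ?_
  rw [integral_smul_measure, integral_map (hm y x).aemeasurable hf.aestronglyMeasurable,
    integral_const_mul, ENNReal.toReal_ofReal (jointProb_nonneg M y x), smul_eq_mul]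

end JointLaw

/-! ### Scores and the weighting of time -/

section Scores

variable {n : ℕ} {𝒴 𝒳 : Type*} [Fintype 𝒴]

/-- The measure on the positive times with the time value function as its density. -/
noncomputable def timeMeasure (M : Model 𝒴 𝒳) : Measure ℝ :=
  (volume.restrict (Ioi 0)).withDensity fun t => ENNReal.ofReal (M.weight t)

lemma isFiniteMeasure_timeMeasure {M : Model 𝒴 𝒳} (h : IntegrableOn M.weight (Ioi 0)) :
    IsFiniteMeasure (timeMeasure M) :=
  isFiniteMeasure_withDensity_ofReal h.hasFiniteIntegral

lemma integral_timeMeasure {M : Model 𝒴 𝒳} (hpos : ∀ t > 0, 0 < M.weight t)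
    (h : IntegrableOn M.weight (Ioi 0)) (f : ℝ → ℝ) :
    ∫ t in Ioi (0 : ℝ), f t * M.weight t = ∫ t, f t ∂timeMeasure M := by
  rw [timeMeasure, integral_withDensity_eq_integral_toReal_smul₀
    h.aestronglyMeasurable.aemeasurable.ennreal_ofReal (by simp)]
  refine setIntegral_congr_fun measurableSet_Ioi fun t ht => ?_
  simp only [smul_eq_mul]
  rw [ENNReal.toReal_ofReal (hpos t ht).le, mul_comm]

lemma timeMeasure_absolutelyContinuous (M : Model 𝒴 𝒳) : timeMeasure M ≪ volume :=
  (withDensity_absolutelyContinuous _ _).trans Measure.restrict_le_self.absolutelyContinuous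

lemma ae_timeMeasure_pos (M : Model 𝒴 𝒳) : ∀ᵐ t ∂timeMeasure M, 0 < t :=
  (withDensity_absolutelyContinuous _ _).ae_le (ae_restrict_mem measurableSet_Ioi)

lemma timeMeasure_Ioo_ne_zero {M : Model 𝒴 𝒳} (hpos : ∀ t > 0, 0 < M.weight t)
    (h : IntegrableOn M.weight (Ioi 0)) {s t : ℝ} (hs : 0 ≤ s) (hst : s < t) :
    timeMeasure M (Ioo s t) ≠ 0 := by
  intro h0
  rw [timeMeasure, withDensity_apply_eq_zero'
    h.aestronglyMeasurable.aemeasurable.ennreal_ofReal] at h0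
  have h1 : (volume.restrict (Ioi (0 : ℝ))) (Ioo s t) = 0 := by
    refine measure_mono_null (fun r hr => ?_) h0
    refine ⟨?_, hr⟩
    simpa using hpos r (hs.trans_lt hr.1)
  rw [Measure.restrict_apply measurableSet_Ioo,
    inter_eq_left.2 fun r hr => mem_Ioi.2 (hs.trans_lt hr.1)] at h1
  rw [Real.volume_Ioo, ENNReal.ofReal_eq_zero] at h1
  linarith

open scoped Classical in
/-- The score of the certain and correct belief. No other score is larger. -/
noncomputable def bestScore (M : Model 𝒴 𝒳) (y : 𝒴) : ℝ :=
  M.score ⟨Pi.single y 1, single_mem_stdSimplex ℝ y⟩ y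

lemma score_le_bestScore {M : Model 𝒴 𝒳} (hscore : StrictlyProper M.score)
    (p : stdSimplex ℝ 𝒴) (y : 𝒴) : M.score p y ≤ bestScore M y := by
  classical
  have := hscore.1 ⟨Pi.single y 1, single_mem_stdSimplex ℝ y⟩ p
  simpa [bestScore, Pi.single_apply] using this

lemma exists_abs_bestScore_le (M : Model 𝒴 𝒳) : ∃ C, ∀ y, |bestScore M y| ≤ C := by
  obtain ⟨C, hC⟩ := (Set.finite_range fun y => |bestScore M y|).bddAbove
  exact ⟨C, fun y => hC ⟨y, rfl⟩⟩

/-- Only finitely many beliefs occur during one play. -/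
lemma exists_abs_score_beliefFrom_le (M : Model 𝒴 𝒳) (H : History n 𝒴) (K : Finset (Fin n))
    (y : 𝒴) : ∃ C, ∀ t, |M.score (beliefFrom M.prior H K t) y| ≤ C := by
  classical
  obtain ⟨C, hC⟩ := (Set.finite_range fun A : Finset (Fin n) =>
    |M.score (bayesUpdate M.prior (∏ j ∈ A, (H j).2)) y|).bddAbove
  exact ⟨C, fun t => hC ⟨_, rfl⟩⟩

/-- Only finitely many posteriors are possible. -/
lemma exists_abs_score_posterior_le [Finite 𝒳] (M : Model 𝒴 𝒳) :
    ∃ C, ∀ (A : Finset (Fin n)) (x : Fin n → 𝒳) y, |M.score (posterior M A x) y| ≤ C := by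
  obtain ⟨C, hC⟩ := (Set.finite_range fun a : Finset (Fin n) × (Fin n → 𝒳) × 𝒴 =>
    |M.score (posterior M a.1 a.2.1) a.2.2|).bddAbove
  exact ⟨C, fun A x y => hC ⟨(A, x, y), rfl⟩⟩

variable [MeasurableSpace 𝒴] [DiscreteMeasurableSpace 𝒴]

lemma measurable_score {M : Model 𝒴 𝒳} (hmeas : ∀ y, Measurable fun p => M.score p y) :
    Measurable fun a : stdSimplex ℝ 𝒴 × 𝒴 => M.score a.1 a.2 :=
  measurable_from_prod_countable_left hmeas

lemma measurable_bestScore (M : Model 𝒴 𝒳) : Measurable (bestScore M) :=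
  measurable_of_countable _

end Scores

/-! ### No belief beats the posterior -/

section Loss

variable {n : ℕ} {𝒴 𝒳 : Type*} [Fintype 𝒴] [MeasurableSpace 𝒴] [DiscreteMeasurableSpace 𝒴]
  [MeasurableSpace 𝒳] {M : Model 𝒴 𝒳}

lemma measurable_score_marketBelief (hmeas : ∀ y, Measurable fun p => M.score p y)
    (σ : Profile n 𝒴 𝒳) :
    Measurable fun a : ℝ × World n 𝒴 𝒳 =>
      M.score (marketBelief M.prior (play σ a.2.2) a.1) a.2.1 :=
  (measurable_score hmeas).comp
    (g := fun a : stdSimplex ℝ 𝒴 × 𝒴 => M.score a.1 a.2)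
    (f := fun a : ℝ × World n 𝒴 𝒳 => (marketBelief M.prior (play σ a.2.2) a.1, a.2.1))
    (((measurable_marketBelief_play M.prior σ).comp
      (g := fun a : ℝ × (Fin n → Private 𝒳) => marketBelief M.prior (play σ a.2) a.1)
      (f := fun a : ℝ × World n 𝒴 𝒳 => (a.1, a.2.2))
      (measurable_fst.prodMk (measurable_snd.comp measurable_snd))).prodMk
      (measurable_fst.comp measurable_snd))

/-- By how much, over time, the score falls short of that of the certain and correct belief. -/
noncomputable def lossOf (M : Model 𝒴 𝒳) (σ : Profile n 𝒴 𝒳) (ω : World n 𝒴 𝒳) : ℝ≥0∞ :=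
  ∫⁻ t, ENNReal.ofReal (bestScore M ω.1 - M.score (marketBelief M.prior (play σ ω.2) t) ω.1)
    ∂timeMeasure M

lemma measurable_loss_integrand (hmeas : ∀ y, Measurable fun p => M.score p y)
    (σ : Profile n 𝒴 𝒳) :
    Measurable fun a : ℝ × World n 𝒴 𝒳 => ENNReal.ofReal
      (bestScore M a.2.1 - M.score (marketBelief M.prior (play σ a.2.2) a.1) a.2.1) :=
  (((measurable_bestScore M).comp (measurable_fst.comp measurable_snd)).sub
    (measurable_score_marketBelief hmeas σ)).ennreal_ofReal

lemma measurable_lossOf [IsFiniteMeasure (timeMeasure M)]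
    (hmeas : ∀ y, Measurable fun p => M.score p y) (σ : Profile n 𝒴 𝒳) :
    Measurable (lossOf M σ) :=
  (measurable_loss_integrand hmeas σ).lintegral_prod_left'

variable [Fintype 𝒳] [DiscreteMeasurableSpace 𝒳]

/-- The posterior given the signals that arrive before `t` is the conditional law of the outcome
given everything that can be known before `t`. -/
lemma lintegral_law_eq_posterior [IsMarkovKernel M.latency] (σ : Profile n 𝒴 𝒳) (t : ℝ)
    {F : 𝒴 → (Fin n → Private 𝒳) → ℝ} (hF : ∀ y, Measurable (F y)) (h0 : ∀ y w, 0 ≤ F y w)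
    (hadapt : ∀ y w w', AgreeBefore (ENNReal.ofReal t) w w' → F y w = F y w') :
    ∫⁻ ω, ENNReal.ofReal (F ω.1 ω.2) ∂law M σ =
      ∫⁻ ω, ENNReal.ofReal (∑ z, (posterior M (arrived t (arrivals ω.2)) (signals ω.2)).1 z *
        F z ω.2) ∂law M σ := by
  have hpost : Measurable fun w : Fin n → Private 𝒳 =>
      posterior M (arrived t (arrivals w)) (signals w) := by
    simp only [← marketBelief_truthful M 0]
    exact (measurable_marketBelief_play M.prior _).comp
      (f := fun w : Fin n → Private 𝒳 => (t, w)) measurable_prodMk_left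
  have hpz : ∀ z, Measurable fun w : Fin n → Private 𝒳 =>
      (posterior M (arrived t (arrivals w)) (signals w)).1 z := fun z =>
    (measurable_pi_apply z).comp (measurable_subtype_coe.comp hpost)
  have hm1 : Measurable fun ω : World n 𝒴 𝒳 => F ω.1 ω.2 :=
    measurable_from_prod_countable_right (f := fun ω : World n 𝒴 𝒳 => F ω.1 ω.2) hF
  have hm2 : Measurable fun ω : World n 𝒴 𝒳 =>
      ∑ z, (posterior M (arrived t (arrivals ω.2)) (signals ω.2)).1 z * F z ω.2 :=
    Finset.measurable_fun_sum _ fun z _ =>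
      ((hpz z).comp measurable_snd).mul ((hF z).comp measurable_snd)
  rw [lintegral_law M σ hm1.ennreal_ofReal, lintegral_law M σ hm2.ennreal_ofReal]
  refine lintegral_congr fun b => ?_
  have hsum : ∀ g : 𝒴 → (Fin n → 𝒳) → ℝ, (∀ y x, 0 ≤ g y x) →
      ∑ y, ∑ x, ENNReal.ofReal (jointProb M y x) * ENNReal.ofReal (g y x) =
        ENNReal.ofReal (∑ y, ∑ x, jointProb M y x * g y x) := by
    intro g hg
    have hnn : ∀ y x, 0 ≤ jointProb M y x * g y x := fun y x =>
      mul_nonneg (jointProb_nonneg M y x) (hg y x)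
    rw [ENNReal.ofReal_sum_of_nonneg fun y _ => Finset.sum_nonneg fun x _ => hnn y x]
    refine Finset.sum_congr rfl fun y _ => ?_
    rw [ENNReal.ofReal_sum_of_nonneg fun x _ => hnn y x]
    exact Finset.sum_congr rfl fun x _ => (ENNReal.ofReal_mul (jointProb_nonneg M y x)).symm
  rw [hsum (fun y x => F y (merge x b)) fun y x => h0 _ _,
    hsum (fun _ x => ∑ z, (posterior M (arrived t b) x).1 z * F z (merge x b)) fun y x =>
      Finset.sum_nonneg fun z _ => mul_nonneg ((posterior M _ x).2.1 z) (h0 _ _)]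
  congr 1
  refine sum_jointProb_mul_eq M (arrived t b) (fun y x => F y (merge x b)) fun y x x' hx => ?_
  exact hadapt _ _ _ fun j => ⟨rfl, fun hj => hx j (mem_arrived.2 hj)⟩

/-- Among all ways to play from the random time `θ` on, the truthful and timely one has the least
expected loss: at each time its belief is the posterior given all signals that have arrived, and
the scoring rule is proper. Any other way has a strictly larger loss if it leads to a different
belief with positive probability at one time, since it then does so during an interval before
this time. -/
theorem lintegral_lossOf_truthful_le [IsMarkovKernel M.latency] [IsFiniteMeasure (timeMeasure M)]
    (hscore : StrictlyProper M.score) (hmeas : ∀ y, Measurable fun p => M.score p y)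
    (hpos : ∀ t > 0, 0 < M.weight t) (hint : IntegrableOn M.weight (Ioi 0))
    (σ σ' : Profile n 𝒴 𝒳) (c : ℝ≥0) {θ : World n 𝒴 𝒳 → ℝ≥0∞} (hθ : Measurable θ)
    (hadapt : ∀ t ω ω', AgreeBefore (ENNReal.ofReal t) ω.2 ω'.2 →
      θ ω < ENNReal.ofReal t → θ ω' < ENNReal.ofReal t)
    (heq : ∀ ω t, ENNReal.ofReal t ≤ θ ω → marketBelief M.prior (play σ' ω.2) t =
      marketBelief M.prior (play (fun _ => truthfulTimely n M c) ω.2) t) :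
    (∫⁻ ω in {ω | θ ω < ∞}, lossOf M (fun _ => truthfulTimely n M c) ω ∂law M σ ≤
      ∫⁻ ω in {ω | θ ω < ∞}, lossOf M σ' ω ∂law M σ) ∧
    ∀ t > 0, law M σ {ω | θ ω < ∞ ∧ marketBelief M.prior (play σ' ω.2) t ≠
        marketBelief M.prior (play (fun _ => truthfulTimely n M c) ω.2) t} ≠ 0 →
      ∫⁻ ω in {ω | θ ω < ∞}, lossOf M (fun _ => truthfulTimely n M c) ω ∂law M σ <
        ∫⁻ ω in {ω | θ ω < ∞}, lossOf M σ' ω ∂law M σ := by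
  classical
  set σ₀ : Profile n 𝒴 𝒳 := fun _ => truthfulTimely n M c with hσ₀
  let q : Profile n 𝒴 𝒳 → ℝ → (Fin n → Private 𝒳) → stdSimplex ℝ 𝒴 := fun σ t w =>
    marketBelief M.prior (play σ w) t
  let S : Set (World n 𝒴 𝒳) := {ω | θ ω < ∞}
  have hS : MeasurableSet S := measurableSet_lt hθ measurable_const
  let f : Profile n 𝒴 𝒳 → ℝ × World n 𝒴 𝒳 → ℝ := fun σ a =>
    bestScore M a.2.1 - M.score (q σ a.1 a.2.2) a.2.1
  have hf0 : ∀ σ a, 0 ≤ f σ a := fun σ a => sub_nonneg.2 (score_le_bestScore hscore _ _)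
  have hfm : ∀ σ, Measurable fun a => ENNReal.ofReal (f σ a) := measurable_loss_integrand hmeas
  have hfm' : ∀ σ, Measurable (f σ) := fun σ =>
    ((measurable_bestScore M).comp (measurable_fst.comp measurable_snd)).sub
      (measurable_score_marketBelief hmeas σ)
  -- the part of the loss after the time `θ`, and its conditional expectation
  let F : Profile n 𝒴 𝒳 → ℝ → 𝒴 → (Fin n → Private 𝒳) → ℝ := fun σ t z w =>
    if θ (z, w) < ENNReal.ofReal t then f σ (t, (z, w)) else 0
  let E : Profile n 𝒴 𝒳 → ℝ × World n 𝒴 𝒳 → ℝ := fun σ a =>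
    ∑ z, (q σ₀ a.1 a.2.2).1 z * F σ a.1 z a.2.2
  let G : ℝ × World n 𝒴 𝒳 → ℝ≥0∞ := fun a =>
    if ENNReal.ofReal a.1 ≤ θ a.2 ∧ θ a.2 < ∞ then ENNReal.ofReal (f σ₀ a) else 0
  have hFm : ∀ σ z, Measurable fun a : ℝ × World n 𝒴 𝒳 => F σ a.1 z a.2.2 := by
    intro σ z
    have hz : Measurable fun a : ℝ × World n 𝒴 𝒳 => (z, a.2.2) :=
      measurable_const.prodMk (measurable_snd.comp measurable_snd)
    refine Measurable.ite (measurableSet_lt (hθ.comp hz) measurable_fst.ennreal_ofReal) ?_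
      measurable_const
    exact (hfm' σ).comp (measurable_fst.prodMk hz)
  have hEm : ∀ σ, Measurable (E σ) := fun σ => by
    refine Finset.measurable_fun_sum _ fun z _ => Measurable.mul ?_ (hFm σ z)
    have h1 : Measurable fun a : ℝ × World n 𝒴 𝒳 => q σ₀ a.1 a.2.2 :=
      (measurable_marketBelief_play M.prior σ₀).comp
        (g := fun a : ℝ × (Fin n → Private 𝒳) => marketBelief M.prior (play σ₀ a.2) a.1)
        (f := fun a : ℝ × World n 𝒴 𝒳 => (a.1, a.2.2))
        (measurable_fst.prodMk (measurable_snd.comp measurable_snd))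
    exact (measurable_pi_apply z).comp (measurable_subtype_coe.comp h1)
  have hGm : Measurable G := by
    refine Measurable.ite ?_ (hfm σ₀) measurable_const
    exact (measurableSet_le measurable_fst.ennreal_ofReal (hθ.comp measurable_snd)).inter
      (measurableSet_lt (hθ.comp measurable_snd) measurable_const)
  have hF0 : ∀ σ t z w, 0 ≤ F σ t z w := by
    intro σ t z w
    simp only [F]
    split_ifs
    · exact hf0 _ _
    · exact le_rfl
  have hcond : ∀ σ' t, ∫⁻ ω, ENNReal.ofReal (F σ' t ω.1 ω.2) ∂law M σ =
      ∫⁻ ω, ENNReal.ofReal (E σ' (t, ω)) ∂law M σ := by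
    intro σ' t
    have := lintegral_law_eq_posterior (M := M) σ t (F := F σ' t) (fun y => ?_) (hF0 σ' t) ?_
    · rw [this]
      refine lintegral_congr fun ω => ?_
      simp only [E, q, hσ₀, marketBelief_truthful]
    · exact (hFm σ' y).comp (f := fun w : Fin n → Private 𝒳 => (t, (y, w)))
        (measurable_const.prodMk (measurable_const.prodMk measurable_id))
    · intro y w w' hw
      have h1 : θ (y, w) < ENNReal.ofReal t ↔ θ (y, w') < ENNReal.ofReal t :=
        ⟨hadapt t (y, w) (y, w') hw, hadapt t (y, w') (y, w) fun j =>
          ⟨(hw j).1.symm, fun hj => ((hw j).2 ((hw j).1 ▸ hj)).symm⟩⟩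
      simp only [F, h1, f, q, marketBelief_congr M.prior (before_play_congr hw σ')]
  have hsplit : ∀ σ' : Profile n 𝒴 𝒳, (∀ ω t, ENNReal.ofReal t ≤ θ ω →
      q σ' t ω.2 = q σ₀ t ω.2) → ∫⁻ ω in S, lossOf M σ' ω ∂law M σ =
        ∫⁻ a, ENNReal.ofReal (E σ' a) ∂(timeMeasure M).prod (law M σ) +
          ∫⁻ a, G a ∂(timeMeasure M).prod (law M σ) := by
    intro σ' hσ'
    rw [lintegral_prod _ (hEm σ').ennreal_ofReal.aemeasurable,
      lintegral_prod _ hGm.aemeasurable]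
    simp only [← hcond]
    have hFm2 : Measurable fun a : ℝ × World n 𝒴 𝒳 => ENNReal.ofReal (F σ' a.1 a.2.1 a.2.2) := by
      refine Measurable.ennreal_ofReal (Measurable.ite ?_ (hfm' σ') measurable_const)
      exact measurableSet_lt (hθ.comp measurable_snd) measurable_fst.ennreal_ofReal
    rw [← lintegral_add_right _ hGm.lintegral_prod_right']
    have : ∀ t, ∫⁻ ω, ENNReal.ofReal (F σ' t ω.1 ω.2) ∂law M σ + ∫⁻ ω, G (t, ω) ∂law M σ =
        ∫⁻ ω in S, ENNReal.ofReal (f σ' (t, ω)) ∂law M σ := by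
      intro t
      have hGt : Measurable fun ω => G (t, ω) := hGm.comp measurable_prodMk_left
      rw [← lintegral_add_right _ hGt, ← lintegral_indicator hS]
      refine lintegral_congr fun ω => ?_
      simp only [F, G, S, indicator_apply, mem_ofPred_eq]
      by_cases h1 : θ ω < ENNReal.ofReal t
      · have h2 : θ ω < ∞ := h1.trans ENNReal.ofReal_lt_top
        simp [h1, h2]
      · have h2 := hσ' ω t (not_lt.1 h1)
        simp only [h1, if_false, ENNReal.ofReal_zero, zero_add, not_lt.1 h1, true_and, f, h2]
    simp only [this, lossOf]
    rw [lintegral_lintegral_swap]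
    exact ((hfm σ').comp measurable_swap).aemeasurable
  have hle : ∀ a, E σ₀ a ≤ E σ' a := by
    intro a
    simp only [E, F]
    by_cases h : ∃ z, θ (z, a.2.2) < ENNReal.ofReal a.1
    · obtain ⟨z₀, hz₀⟩ := h
      have hall : ∀ z, θ (z, a.2.2) < ENNReal.ofReal a.1 := fun z =>
        hadapt a.1 (z₀, a.2.2) (z, a.2.2) (fun j => ⟨rfl, fun _ => rfl⟩) hz₀
      simp only [hall, if_true, f, mul_sub, Finset.sum_sub_distrib]
      exact sub_le_sub_left (hscore.1 _ _) _
    · simp only [not_exists] at h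
      simp [h]
  have hlt : ∀ a, θ a.2 < ENNReal.ofReal a.1 → q σ' a.1 a.2.2 ≠ q σ₀ a.1 a.2.2 →
      E σ₀ a < E σ' a := by
    intro a h hne
    have hall : ∀ z, θ (z, a.2.2) < ENNReal.ofReal a.1 := fun z =>
      hadapt a.1 a.2 (z, a.2.2) (fun j => ⟨rfl, fun _ => rfl⟩) h
    simp only [E, F, hall, if_true, f, mul_sub, Finset.sum_sub_distrib]
    refine sub_lt_sub_left (lt_of_le_of_ne (hscore.1 _ _) fun h1 => hne ?_) _
    exact (hscore.2 _ _ h1).symm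
  have hbound : ∫⁻ ω in S, lossOf M σ₀ ω ∂law M σ ≠ ∞ := by
    obtain ⟨C, hC⟩ := exists_abs_score_posterior_le (n := n) M
    obtain ⟨B, hB⟩ := exists_abs_bestScore_le M
    have h1 : ∀ ω, lossOf M σ₀ ω ≤ ENNReal.ofReal (B + C) * timeMeasure M univ := by
      intro ω
      rw [lossOf, ← lintegral_const]
      refine lintegral_mono fun t => ENNReal.ofReal_le_ofReal ?_
      rw [hσ₀, marketBelief_truthful]
      have := abs_le.1 (hC (arrived t (arrivals ω.2)) (signals ω.2) ω.1)
      have := abs_le.1 (hB ω.1)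
      linarith
    refine ne_top_of_le_ne_top ?_ (setLIntegral_le_lintegral S _)
    refine ne_top_of_le_ne_top ?_ (lintegral_mono h1)
    rw [lintegral_const, measure_univ (μ := law M σ), mul_one]
    exact ENNReal.mul_ne_top ENNReal.ofReal_ne_top (measure_ne_top _ _)
  have hs₀ := hsplit σ₀ fun _ _ _ => rfl
  have hs' := hsplit σ' heq
  constructor
  · rw [hs₀, hs']
    exact add_le_add_left (lintegral_mono fun a => ENNReal.ofReal_le_ofReal (hle a)) _
  · intro t ht hbad
    rw [hs₀] at hbound ⊢
    rw [hs']
    obtain ⟨hE, hG⟩ := ENNReal.add_ne_top.1 hbound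
    refine ENNReal.add_lt_add_right hG ?_
    refine lintegral_strict_mono_of_ae_le_of_ae_lt_on (hEm σ').ennreal_ofReal.aemeasurable hE
      (.of_forall fun a => ENNReal.ofReal_le_ofReal (hle a))
      (s := {a | E σ₀ a < E σ' a}) ?_ (.of_forall fun a ha => ?_)
    · intro h0
      have hms : MeasurableSet {a | E σ₀ a < E σ' a} := measurableSet_lt (hEm _) (hEm _)
      have hae : ∀ᵐ ω ∂law M σ, ∀ᵐ r ∂timeMeasure M, ¬ E σ₀ (r, ω) < E σ' (r, ω) := by
        rw [Measure.ae_ae_comm ((hms.preimage measurable_swap).compl)]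
        exact Measure.ae_ae_of_ae_prod (measure_eq_zero_iff_ae_notMem.1 h0)
      obtain ⟨ω, ⟨hω, hne⟩, hω'⟩ := ((frequently_ae_mem_iff.2 hbad).and_eventually hae).exists
      have hev : ∀ᶠ r in nhdsWithin t (Iio t), E σ₀ (r, ω) < E σ' (r, ω) := by
        filter_upwards [eventually_marketBelief_eq M.prior (play σ' ω.2) t,
          eventually_marketBelief_eq M.prior (play σ₀ ω.2) t] with r h1 h2
        have hr : q σ' r ω.2 ≠ q σ₀ r ω.2 := by
          simp only [q, h1, h2]
          exact hne
        exact hlt (r, ω) (not_le.1 fun h => hr (heq ω r h)) hr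
      obtain ⟨s, hs, hsub⟩ := (mem_nhdsLT_iff_exists_Ioo_subset).1 hev
      refine timeMeasure_Ioo_ne_zero hpos hint (le_max_right s 0) (max_lt hs ht)
        (measure_mono_null (fun r hr => ?_) hω')
      exact not_not.2 (hsub ⟨(le_max_left s 0).trans_lt hr.1, hr.2⟩)
    · have h1 : 0 ≤ E σ₀ a := Finset.sum_nonneg fun z _ =>
        mul_nonneg ((q σ₀ a.1 a.2.2).2.1 z) (hF0 _ _ _ _)
      exact (ENNReal.ofReal_lt_ofReal_iff (h1.trans_lt ha)).2 ha

end Loss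

section Reward

variable {n : ℕ} {𝒴 𝒳 : Type*} [Fintype 𝒴] {M : Model 𝒴 𝒳}

lemma integrable_score_beliefFrom [IsFiniteMeasure (timeMeasure M)]
    (hmeas : ∀ y, Measurable fun p => M.score p y) (H : History n 𝒴) (K : Finset (Fin n))
    (y : 𝒴) : Integrable (fun t => M.score (beliefFrom M.prior H K t) y) (timeMeasure M) := by
  obtain ⟨C, hC⟩ := exists_abs_score_beliefFrom_le M H K y
  refine Integrable.of_bound (Measurable.aestronglyMeasurable ?_) C (.of_forall hC)
  exact (hmeas y).comp ((measurable_beliefFrom M.prior K).comp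
    (g := fun a : History n 𝒴 × ℝ => beliefFrom M.prior a.1 K a.2)
    (f := fun t => (H, t)) measurable_prodMk_left)

section Play

variable [MeasurableSpace 𝒳]

lemma lossOf_ne_top [IsFiniteMeasure (timeMeasure M)] (σ : Profile n 𝒴 𝒳) (ω : World n 𝒴 𝒳) :
    lossOf M σ ω ≠ ∞ := by
  obtain ⟨C, hC⟩ := exists_abs_score_beliefFrom_le M (play σ ω.2) Finset.univ ω.1
  refine ne_top_of_le_ne_top (b := ENNReal.ofReal (bestScore M ω.1 + C) * timeMeasure M univ)
    (ENNReal.mul_ne_top ENNReal.ofReal_ne_top (measure_ne_top _ _)) ?_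
  rw [lossOf, ← lintegral_const]
  refine lintegral_mono fun t => ENNReal.ofReal_le_ofReal ?_
  have := (abs_le.1 (hC t)).1
  simp only [marketBelief]
  linarith

lemma toReal_lossOf [IsFiniteMeasure (timeMeasure M)]
    (hscore : StrictlyProper M.score) (hmeas : ∀ y, Measurable fun p => M.score p y)
    (σ : Profile n 𝒴 𝒳) (ω : World n 𝒴 𝒳) :
    (lossOf M σ ω).toReal =
      ∫ t, (bestScore M ω.1 - M.score (marketBelief M.prior (play σ ω.2) t) ω.1)
        ∂timeMeasure M := by
  rw [lossOf, integral_eq_lintegral_of_nonneg_ae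
    (.of_forall fun t => sub_nonneg.2 (score_le_bestScore hscore _ _))]
  exact aestronglyMeasurable_const.sub
    (integrable_score_beliefFrom hmeas (play σ ω.2) Finset.univ ω.1).1

lemma value_eq [IsFiniteMeasure (timeMeasure M)]
    (hscore : StrictlyProper M.score) (hmeas : ∀ y, Measurable fun p => M.score p y)
    (hpos : ∀ t > 0, 0 < M.weight t) (hint : IntegrableOn M.weight (Ioi 0))
    (σ : Profile n 𝒴 𝒳) (ω : World n 𝒴 𝒳) :
    value M.prior M.score M.weight (play σ ω.2) ω.1 =
      bestScore M ω.1 * (timeMeasure M).real univ - (lossOf M σ ω).toReal := by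
  have h : Integrable (fun t => M.score (marketBelief M.prior (play σ ω.2) t) ω.1)
      (timeMeasure M) := integrable_score_beliefFrom hmeas _ Finset.univ _
  rw [value, integral_timeMeasure hpos hint, toReal_lossOf hscore hmeas,
    integral_sub (integrable_const _) h, integral_const, smul_eq_mul]
  ring

/-- The loss of the counterfactual beliefs for the absence of agent `i`. -/
noncomputable def counterfactualLoss (M : Model 𝒴 𝒳) (σ : Profile n 𝒴 𝒳) (i : Fin n)
    (ω : World n 𝒴 𝒳) : ℝ :=
  ∫ t, (bestScore M ω.1 - M.score (counterfactualBelief M.prior (play σ ω.2) i t) ω.1)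
    ∂timeMeasure M

lemma reward_eq [IsFiniteMeasure (timeMeasure M)]
    (hscore : StrictlyProper M.score) (hmeas : ∀ y, Measurable fun p => M.score p y)
    (hpos : ∀ t > 0, 0 < M.weight t) (hint : IntegrableOn M.weight (Ioi 0))
    (σ : Profile n 𝒴 𝒳) (i : Fin n) (ω : World n 𝒴 𝒳) :
    reward M.prior M.score M.weight (play σ ω.2) i ω.1 =
      counterfactualLoss M σ i ω - (lossOf M σ ω).toReal := by
  have hc : Integrable (fun _ => bestScore M ω.1) (timeMeasure M) := integrable_const _
  have h1 : Integrable (fun t => bestScore M ω.1 -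
      M.score (counterfactualBelief M.prior (play σ ω.2) i t) ω.1) (timeMeasure M) :=
    hc.sub (integrable_score_beliefFrom hmeas _ _ _)
  have h2 : Integrable (fun t => bestScore M ω.1 -
      M.score (marketBelief M.prior (play σ ω.2) t) ω.1) (timeMeasure M) :=
    hc.sub (integrable_score_beliefFrom hmeas _ _ _)
  rw [reward, integral_timeMeasure hpos hint, toReal_lossOf hscore hmeas, counterfactualLoss,
    ← integral_sub h1 h2]
  refine integral_congr_ae (.of_forall fun t => ?_)
  ring

lemma measurable_counterfactualLoss [MeasurableSpace 𝒴] [DiscreteMeasurableSpace 𝒴]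
    [IsFiniteMeasure (timeMeasure M)]
    (hmeas : ∀ y, Measurable fun p => M.score p y) (σ : Profile n 𝒴 𝒳) (i : Fin n) :
    Measurable (counterfactualLoss M σ i) := by
  have h : Measurable fun a : World n 𝒴 𝒳 × ℝ =>
      (counterfactualBelief M.prior (play σ a.1.2) i a.2, a.1.1) :=
    Measurable.prodMk ((measurable_beliefFrom M.prior (Finset.univ.erase i)).comp
      (g := fun a : History n 𝒴 × ℝ => beliefFrom M.prior a.1 (Finset.univ.erase i) a.2)
      (f := fun a : World n 𝒴 𝒳 × ℝ => (play σ a.1.2, a.2))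
      (((measurable_play σ).comp (measurable_snd.comp measurable_fst)).prodMk measurable_snd))
      (measurable_fst.comp measurable_fst)
  have h2 : Measurable fun a : World n 𝒴 𝒳 × ℝ => bestScore M a.1.1 -
      M.score (counterfactualBelief M.prior (play σ a.1.2) i a.2) a.1.1 :=
    ((measurable_bestScore M).comp (measurable_fst.comp measurable_fst)).sub
      ((measurable_score hmeas).comp h)
  exact h2.stronglyMeasurable.integral_prod_right.measurable

end Play

section Truthful

variable [Fintype 𝒳] [MeasurableSpace 𝒳] [DiscreteMeasurableSpace 𝒳]

/-- The other agents being truthful and timely, an agent has no influence on the counterfactual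
beliefs for his absence. -/
lemma counterfactualLoss_deviate (M : Model 𝒴 𝒳) (c : ℝ≥0) (i : Fin n) (τ : Strategy n 𝒴 𝒳) :
    counterfactualLoss M (deviate (fun _ => truthfulTimely n M c) i τ) i =
      counterfactualLoss M (fun _ => truthfulTimely n M c) i := by
  funext ω
  simp only [counterfactualLoss, counterfactualBelief_deviate, counterfactualBelief_truthful]

lemma exists_abs_counterfactualLoss_le [IsFiniteMeasure (timeMeasure M)] (c : ℝ≥0) (i : Fin n) :
    ∃ C, ∀ ω : World n 𝒴 𝒳,
      |counterfactualLoss M (fun _ => truthfulTimely n M c) i ω| ≤ C := by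
  obtain ⟨C, hC⟩ := exists_abs_score_posterior_le (n := n) M
  obtain ⟨B, hB⟩ := exists_abs_bestScore_le M
  refine ⟨(B + C) * (timeMeasure M).real univ, fun ω => ?_⟩
  rw [counterfactualLoss, ← Real.norm_eq_abs]
  refine norm_integral_le_of_norm_le_const (.of_forall fun t => ?_)
  rw [counterfactualBelief_truthful]
  exact (norm_sub_le _ _).trans (add_le_add (hB _) (hC _ _ _))

lemma exists_lossOf_truthful_le [IsFiniteMeasure (timeMeasure M)] (c : ℝ≥0) :
    ∃ C : ℝ≥0, ∀ ω : World n 𝒴 𝒳, lossOf M (fun _ => truthfulTimely n M c) ω ≤ C := by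
  obtain ⟨C, hC⟩ := exists_abs_score_posterior_le (n := n) M
  obtain ⟨B, hB⟩ := exists_abs_bestScore_le M
  have hfin : ENNReal.ofReal (B + C) * timeMeasure M univ ≠ ∞ :=
    ENNReal.mul_ne_top ENNReal.ofReal_ne_top (measure_ne_top _ _)
  refine ⟨(ENNReal.ofReal (B + C) * timeMeasure M univ).toNNReal, fun ω => ?_⟩
  rw [ENNReal.coe_toNNReal hfin, lossOf, ← lintegral_const]
  refine lintegral_mono fun t => ENNReal.ofReal_le_ofReal ?_
  rw [marketBelief_truthful]
  have := abs_le.1 (hC (arrived t (arrivals ω.2)) (signals ω.2) ω.1)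
  have := abs_le.1 (hB ω.1)
  linarith

end Truthful

/-- If `a` is bounded above and `a - L'` is integrable, then `a` is integrable, and expectations of
`a - L` and `a - L'` compare like those of `L'` and `L`. -/
lemma integral_sub_toReal_le {Ω : Type*} [MeasurableSpace Ω] {μ : Measure Ω} [IsFiniteMeasure μ]
    {a : Ω → ℝ} {L L' : Ω → ℝ≥0∞} {A : ℝ} {B : ℝ≥0} (ha : Measurable a) (haA : ∀ ω, a ω ≤ A)
    (hL : Measurable L) (hLB : ∀ ω, L ω ≤ B) (hL' : Measurable L') (hfin : ∀ ω, L' ω ≠ ∞)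
    (hint : Integrable (fun ω => a ω - (L' ω).toReal) μ) :
    Integrable a μ ∧ Integrable (fun ω => a ω - (L ω).toReal) μ ∧
      (∫⁻ ω, L ω ∂μ ≤ ∫⁻ ω, L' ω ∂μ →
        ∫ ω, (a ω - (L' ω).toReal) ∂μ ≤ ∫ ω, (a ω - (L ω).toReal) ∂μ) ∧
      (∫⁻ ω, L ω ∂μ < ∫⁻ ω, L' ω ∂μ →
        ∫ ω, (a ω - (L' ω).toReal) ∂μ < ∫ ω, (a ω - (L ω).toReal) ∂μ) := by
  have hai : Integrable a μ := by
    refine Integrable.mono' (hint.abs.add (integrable_const |A|)) ha.aestronglyMeasurable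
      (.of_forall fun ω => ?_)
    have h0 : 0 ≤ (L' ω).toReal := ENNReal.toReal_nonneg
    have h1 := haA ω
    simp only [Pi.add_apply, Real.norm_eq_abs]
    rcases le_total 0 (a ω) with h | h
    · rw [abs_of_nonneg h]
      exact (h1.trans (le_abs_self A)).trans (le_add_of_nonneg_left (abs_nonneg _))
    · rw [abs_of_nonpos h, abs_of_nonpos (by linarith)]
      have := abs_nonneg A
      linarith
  have hL'i : Integrable (fun ω => (L' ω).toReal) μ := by
    refine (hai.sub hint).congr (.of_forall fun ω => ?_)
    simp
  have hL'f : ∫⁻ ω, L' ω ∂μ ≠ ∞ := by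
    have := hL'i.lintegral_lt_top
    simpa [ENNReal.ofReal_toReal (hfin _)] using this.ne
  have hLf : ∫⁻ ω, L ω ∂μ ≠ ∞ := by
    refine ne_top_of_le_ne_top ?_ (lintegral_mono hLB)
    rw [lintegral_const]
    exact ENNReal.mul_ne_top ENNReal.coe_ne_top (measure_ne_top _ _)
  have hLi : Integrable (fun ω => (L ω).toReal) μ :=
    integrable_toReal_of_lintegral_ne_top hL.aemeasurable hLf
  refine ⟨hai, hai.sub hLi, ?_, ?_⟩
  all_goals
    rw [integral_sub hai hL'i, integral_sub hai hLi,
      integral_toReal hL.aemeasurable (ae_lt_top hL hLf),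
      integral_toReal hL'.aemeasurable (ae_lt_top hL' hL'f)]
    intro h
  · exact sub_le_sub_left ((ENNReal.toReal_le_toReal hLf hL'f).2 h) _
  · exact sub_lt_sub_left ((ENNReal.toReal_lt_toReal hLf hL'f).2 h) _

end Reward

/-! ### Functions of a random set with independent members -/

section RandomSubset

variable {ι : Type*} [Fintype ι] [DecidableEq ι]

/-- The probability that a random set, which contains each `j` independently with probability
`g j`, equals `A`. -/
def subsetProb (g : ι → ℝ) (A : Finset ι) : ℝ :=
  ∏ j, if j ∈ A then g j else 1 - g j

/-- The expectation of `v` at the random set with membership probabilities `g`. -/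
def expected (v : Finset ι → ℝ) (g : ι → ℝ) : ℝ :=
  ∑ A, subsetProb g A * v A

/-- The expected marginal contribution of `i` to `v` at the random set with membership
probabilities `g`. It is independent of `g i`. -/
def marginal (v : Finset ι → ℝ) (g : ι → ℝ) (i : ι) : ℝ :=
  ∑ A, subsetProb g A * (v (insert i A) - v (A.erase i))

lemma subsetProb_nonneg {g : ι → ℝ} (hg : ∀ j, g j ∈ Icc (0 : ℝ) 1) (A : Finset ι) :
    0 ≤ subsetProb g A :=
  Finset.prod_nonneg fun j _ => by
    split_ifs
    · exact (hg j).1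
    · exact sub_nonneg.2 (hg j).2

lemma sum_subsetProb (g : ι → ℝ) : ∑ A, subsetProb g A = 1 := by
  have h := Finset.prod_add g (fun j => 1 - g j) Finset.univ
  simp only [add_sub_cancel, Finset.prod_const_one, Finset.powerset_univ] at h
  rw [h]
  refine Finset.sum_congr rfl fun A _ => ?_
  rw [subsetProb, Finset.prod_ite]
  congr 2
  · ext; simp
  · ext; simp

lemma subsetProb_of_notMem (g : ι → ℝ) {i : ι} {A : Finset ι} (h : i ∉ A) :
    subsetProb g A = (1 - g i) * ∏ j ∈ Finset.univ.erase i, if j ∈ A then g j else 1 - g j := by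
  rw [subsetProb, ← Finset.mul_prod_erase _ _ (Finset.mem_univ i), if_neg h]

lemma subsetProb_insert (g : ι → ℝ) (i : ι) (A : Finset ι) :
    subsetProb g (insert i A) =
      g i * ∏ j ∈ Finset.univ.erase i, if j ∈ A then g j else 1 - g j := by
  rw [subsetProb, ← Finset.mul_prod_erase _ _ (Finset.mem_univ i),
    if_pos (Finset.mem_insert_self i A)]
  congr 1
  refine Finset.prod_congr rfl fun j hj => ?_
  simp [Finset.mem_insert, Finset.ne_of_mem_erase hj]

lemma sum_finset_eq_sum_notMem (i : ι) (f : Finset ι → ℝ) :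
    ∑ A, f A = ∑ A ∈ (Finset.univ.erase i).powerset, (f A + f (insert i A)) := by
  rw [Finset.sum_add_distrib, ← Finset.sum_powerset_insert (Finset.notMem_erase i _),
    Finset.insert_erase (Finset.mem_univ i), Finset.powerset_univ]

/-- Conditioning on the membership of `i`. -/
lemma expected_update (v : Finset ι → ℝ) (g : ι → ℝ) (i : ι) (x : ℝ) :
    expected v (Function.update g i x) =
      ∑ A, subsetProb g A * (x * v (insert i A) + (1 - x) * v (A.erase i)) := by
  rw [expected, sum_finset_eq_sum_notMem i, sum_finset_eq_sum_notMem i]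
  refine Finset.sum_congr rfl fun A hA => ?_
  have hi : i ∉ A := fun h => Finset.notMem_erase i _ (Finset.mem_powerset.1 hA h)
  have hR : (∏ j ∈ Finset.univ.erase i, if j ∈ A then Function.update g i x j
      else 1 - Function.update g i x j) =
      ∏ j ∈ Finset.univ.erase i, if j ∈ A then g j else 1 - g j :=
    Finset.prod_congr rfl fun j hj => by
      rw [Function.update_of_ne (Finset.ne_of_mem_erase hj)]
  rw [subsetProb_of_notMem _ hi, subsetProb_insert, subsetProb_of_notMem _ hi, subsetProb_insert,
    hR, Function.update_self, Finset.erase_eq_of_notMem hi, Finset.insert_idem,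
    Finset.erase_insert hi]
  ring

lemma expected_update_sub (v : Finset ι → ℝ) (g : ι → ℝ) (i : ι) (x : ℝ) :
    expected (fun A => v A - v (A.erase i)) (Function.update g i x) = x * marginal v g i := by
  rw [expected_update, marginal, Finset.mul_sum]
  refine Finset.sum_congr rfl fun A _ => ?_
  simp only [Finset.erase_insert_eq_erase, Finset.erase_idem]
  ring

lemma differentiable_expected (v : Finset ι → ℝ) : Differentiable ℝ (expected v) := by
  unfold expected subsetProb
  refine Differentiable.fun_sum fun A _ => Differentiable.mul_const ?_ _
  have h : ∀ j, Differentiable ℝ fun g : ι → ℝ => if j ∈ A then g j else 1 - g j := fun j => by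
    split_ifs <;> fun_prop
  exact fun g => (HasFDerivAt.finsetProd fun j _ => (h j g).hasFDerivAt).differentiableAt

/-- If all membership probabilities increase at unit rate, then the expectation increases at a
rate which is the sum of the expected marginal contributions. -/
lemma hasDerivAt_expected_diag (v : Finset ι → ℝ) (s : ℝ) :
    HasDerivAt (fun s => expected v fun _ => s) (∑ i, marginal v (fun _ => s) i) s := by
  have hL := (differentiable_expected v (fun _ => s)).hasFDerivAt
  set L := fderiv ℝ (expected v) fun _ => s
  have h1 : HasDerivAt (fun (s : ℝ) (_ : ι) => s) (fun _ => 1) s :=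
    hasDerivAt_pi.2 fun _ => hasDerivAt_id s
  have h2 : ∀ i, L (Pi.single i 1) = marginal v (fun _ => s) i := by
    intro i
    have hu := hasDerivAt_update (𝕜 := ℝ) (fun _ : ι => s) i s
    have h3 : HasDerivAt (fun x => expected v (Function.update (fun _ => s) i x))
        (L (Pi.single i 1)) s :=
      HasFDerivAt.comp_hasDerivAt (l := expected v) s (by rwa [Function.update_eq_self]) hu
    refine h3.unique ?_
    simp only [expected_update, marginal]
    refine HasDerivAt.fun_sum fun A _ => HasDerivAt.const_mul _ ?_
    have h4 : HasDerivAt (fun x => x * v (insert i A) + (1 - x) * v (A.erase i))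
        (1 * v (insert i A) + (0 - 1) * v (A.erase i)) s :=
      ((hasDerivAt_id' s).mul_const _).add
        (((hasDerivAt_const s (1 : ℝ)).sub (hasDerivAt_id' s)).mul_const _)
    exact h4.congr_deriv (by ring)
  have h5 : L (fun _ => 1) = ∑ i, marginal v (fun _ => s) i := by
    rw [show (fun _ : ι => (1 : ℝ)) = ∑ i, Pi.single i 1 from
      (Finset.univ_sum_single (fun _ : ι => (1 : ℝ))).symm, map_sum]
    exact Finset.sum_congr rfl fun i _ => h2 i
  rw [← h5]
  exact hL.comp_hasDerivAt s h1

lemma marginal_nonneg {v : Finset ι → ℝ} (hv : Monotone v) {g : ι → ℝ}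
    (hg : ∀ j, g j ∈ Icc (0 : ℝ) 1) (i : ι) : 0 ≤ marginal v g i :=
  Finset.sum_nonneg fun A _ => mul_nonneg (subsetProb_nonneg hg A)
    (sub_nonneg.2 (hv ((Finset.erase_subset i A).trans (Finset.subset_insert i A))))

lemma abs_expected_le {v : Finset ι → ℝ} {C : ℝ} (hv : ∀ A, |v A| ≤ C) {g : ι → ℝ}
    (hg : ∀ j, g j ∈ Icc (0 : ℝ) 1) : |expected v g| ≤ C := by
  refine (Finset.abs_sum_le_sum_abs _ _).trans ?_
  rw [← one_mul C, ← sum_subsetProb g, Finset.sum_mul]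
  refine Finset.sum_le_sum fun A _ => ?_
  rw [abs_mul, abs_of_nonneg (subsetProb_nonneg hg A)]
  exact mul_le_mul_of_nonneg_left (hv A) (subsetProb_nonneg hg A)

/-- If `v` is invariant under permutations and the membership probabilities are equal, then all
members have the same expected marginal contribution. -/
lemma marginal_const_eq {v : Finset ι → ℝ}
    (hv : ∀ (e : Equiv.Perm ι) A, v (A.map e.toEmbedding) = v A) (s : ℝ) (i k : ι) :
    marginal v (fun _ => s) i = marginal v (fun _ => s) k := by
  set e : Equiv.Perm ι := Equiv.swap i k
  refine Fintype.sum_equiv (Equiv.finsetCongr e) _ _ fun A => ?_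
  have hprob : subsetProb (fun _ : ι => s) (A.map e.toEmbedding) = subsetProb (fun _ => s) A := by
    rw [subsetProb, subsetProb, ← Equiv.prod_comp e]
    simp
  have hins : insert k (A.map e.toEmbedding) = (insert i A).map e.toEmbedding := by
    rw [Finset.map_insert]
    simp [e]
  have hera : (A.map e.toEmbedding).erase k = (A.erase i).map e.toEmbedding := by
    rw [Finset.map_erase]
    simp [e]
  rw [Equiv.finsetCongr_apply, hprob, hins, hera, hv, hv]

lemma continuous_marginal_diag (v : Finset ι → ℝ) (i : ι) :
    Continuous fun s => marginal v (fun _ => s) i := by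
  unfold marginal subsetProb
  refine continuous_finsetSum _ fun A _ => Continuous.mul ?_ continuous_const
  refine continuous_finsetProd _ fun j _ => ?_
  split_ifs <;> fun_prop

end RandomSubset

/-! ### Optimal efforts -/

section Optimum

variable {ν : Measure ℝ} [IsFiniteMeasure ν] {F : ℝ → ℝ → ℝ} {B D : ℝ → ℝ} {n : ℝ}

lemma monotoneOn_Icc_of_hasDerivAt (hB : ∀ s, HasDerivAt B (n * D s) s)
    (hD : ∀ s ∈ Icc (0 : ℝ) 1, 0 ≤ D s) (hn : 0 ≤ n) : MonotoneOn B (Icc 0 1) := by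
  refine monotoneOn_of_deriv_nonneg (convex_Icc 0 1)
    (fun s _ => (hB s).continuousAt.continuousWithinAt)
    (fun s _ => (hB s).differentiableAt.differentiableWithinAt) fun s hs => ?_
  rw [(hB s).deriv]
  exact mul_nonneg hn (hD s (interior_subset hs))

/-- The common effort of all agents that maximizes the welfare exists, since the welfare is
continuous and tends to `-∞`. -/
lemma exists_optimal_effort (hn : 0 < n) (hB : Continuous B)
    (hF01 : ∀ᵐ t ∂ν, ∀ c, F c t ∈ Icc (0 : ℝ) 1)
    (hFm : ∀ c, AEStronglyMeasurable (F c) ν)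
    (hFc : ∀ᵐ t ∂ν, ContinuousOn (fun c => F c t) (Ici 0)) :
    ∃ c ≥ 0, ∀ c' ≥ 0, ∫ t, B (F c' t) ∂ν - n * c' ≤ ∫ t, B (F c t) ∂ν - n * c := by
  obtain ⟨K, hK⟩ := isCompact_Icc.exists_bound_of_continuousOn (s := Icc (0 : ℝ) 1)
    hB.continuousOn
  have hbd : ∀ c, ∀ᵐ t ∂ν, ‖B (F c t)‖ ≤ K := fun c => by
    filter_upwards [hF01] with t ht using hK _ (ht c)
  have hcont : ContinuousOn (fun c => ∫ t, B (F c t) ∂ν - n * c) (Ici 0) := by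
    refine ContinuousOn.sub (continuousOn_of_dominated (bound := fun _ => K) ?_ ?_ ?_ ?_)
      (by fun_prop)
    · exact fun c _ => hB.comp_aestronglyMeasurable (hFm c)
    · exact fun c _ => hbd c
    · exact integrable_const K
    · filter_upwards [hFc] with t ht using hB.comp_continuousOn ht
  have hle : ∀ c, |∫ t, B (F c t) ∂ν| ≤ K * ν.real univ := fun c => by
    rw [← Real.norm_eq_abs]
    exact norm_integral_le_of_norm_le_const (hbd c)
  set R : ℝ := 2 * (K * ν.real univ) / n with hR
  have hK0 : 0 ≤ K * ν.real univ := (abs_nonneg _).trans (hle 0)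
  have hR0 : 0 ≤ R := by positivity
  obtain ⟨c, hc, hmax⟩ := isCompact_Icc.exists_isMaxOn (s := Icc 0 R) ⟨0, left_mem_Icc.2 hR0⟩
    (hcont.mono Icc_subset_Ici_self)
  refine ⟨c, hc.1, fun c' hc' => ?_⟩
  rcases le_total c' R with h | h
  · exact hmax ⟨hc', h⟩
  · refine le_trans ?_ (hmax (left_mem_Icc.2 hR0))
    have h1 := (abs_le.1 (hle c')).2
    have h2 := (abs_le.1 (hle 0)).1
    have h3 : 2 * (K * ν.real univ) ≤ n * c' := by
      rw [hR, div_le_iff₀ hn] at h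
      linarith
    simp only [mul_zero, sub_zero]
    linarith

/-- The first-order condition at the best common effort `c`: as all agents contribute equally at
the margin, the condition for the common effort is the one for the best response of a single
agent, whose payoff is concave in his effort. Efforts need not change differentiably here; the
probability of arrival at an intermediate effort is compared with the interpolated probability. -/
lemma first_order_condition (hn : 0 < n) (hB : ∀ s, HasDerivAt B (n * D s) s)
    (hD : ∀ s ∈ Icc (0 : ℝ) 1, 0 ≤ D s) (hDc : Continuous D)
    (hF01 : ∀ᵐ t ∂ν, ∀ c, F c t ∈ Icc (0 : ℝ) 1)
    (hFm : ∀ c, AEStronglyMeasurable (F c) ν)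
    (hFconc : ∀ᵐ t ∂ν, ConcaveOn ℝ (Ici 0) fun c => F c t) {c : ℝ} (hc : 0 ≤ c)
    (hmax : ∀ c' ≥ 0, ∫ t, B (F c' t) ∂ν - n * c' ≤ ∫ t, B (F c t) ∂ν - n * c)
    {x : ℝ} (hx : 0 ≤ x) :
    ∫ t, (F x t - F c t) * D (F c t) ∂ν ≤ x - c := by
  have hBc : Continuous B := continuous_iff_continuousAt.2 fun s => (hB s).continuousAt
  have hmono := monotoneOn_Icc_of_hasDerivAt hB hD hn.le
  obtain ⟨K, hK⟩ := isCompact_Icc.exists_bound_of_continuousOn (s := Icc (0 : ℝ) 1)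
    hBc.continuousOn
  obtain ⟨L, hL⟩ := isCompact_Icc.exists_bound_of_continuousOn (s := Icc (0 : ℝ) 1)
    hDc.continuousOn
  let a : ℝ → ℝ → ℝ := fun ε t => F c t + ε * (F x t - F c t)
  have ha : ∀ᵐ t ∂ν, ∀ ε ∈ Ioo (0 : ℝ) 1, a ε t ∈ Icc (0 : ℝ) 1 := by
    filter_upwards [hF01] with t ht ε hε
    have h1 := ht c
    have h2 := ht x
    have h3 : a ε t = (1 - ε) * F c t + ε * F x t := by simp only [a]; ring
    rw [h3]
    have e0 := hε.1.le
    have e1 : 0 ≤ 1 - ε := by linarith [hε.2]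
    constructor
    · exact add_nonneg (mul_nonneg e1 h1.1) (mul_nonneg e0 h2.1)
    · nlinarith [h1.2, h2.2]
  have ham : ∀ ε, AEStronglyMeasurable (a ε) ν := fun ε =>
    (hFm c).add (((hFm x).sub (hFm c)).const_mul ε)
  have hint : ∀ {g : ℝ → ℝ}, AEStronglyMeasurable g ν → (∀ᵐ t ∂ν, g t ∈ Icc (0 : ℝ) 1) →
      Integrable (fun t => B (g t)) ν := fun hg h01 =>
    Integrable.of_bound (hBc.comp_aestronglyMeasurable hg) K (h01.mono fun t ht => hK _ ht)
  have hFi : ∀ c, Integrable (fun t => B (F c t)) ν := fun c =>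
    hint (hFm c) (hF01.mono fun t ht => ht c)
  -- by optimality, difference quotients of the value of information are at most those of the cost
  have hquot : ∀ ε ∈ Ioo (0 : ℝ) 1, ∫ t, ε⁻¹ * (B (a ε t) - B (F c t)) ∂ν ≤ n * (x - c) := by
    intro ε hε
    have hai : Integrable (fun t => B (a ε t)) ν := hint (ham ε) (ha.mono fun t ht => ht ε hε)
    set y : ℝ := (1 - ε) * c + ε * x with hy
    have e1 : 0 ≤ 1 - ε := by linarith [hε.2]
    have hy0 : 0 ≤ y := add_nonneg (mul_nonneg e1 hc) (mul_nonneg hε.1.le hx)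
    have h1 : ∫ t, B (a ε t) ∂ν ≤ ∫ t, B (F y t) ∂ν := by
      refine integral_mono_ae hai (hFi y) ?_
      filter_upwards [hF01, ha, hFconc] with t ht hat hconc
      refine hmono (hat ε hε) (ht y) ?_
      have := hconc.2 (mem_Ici.2 hc) (mem_Ici.2 hx) e1 hε.1.le (by ring)
      simp only [smul_eq_mul] at this
      refine le_trans (le_of_eq ?_) this
      simp only [a]
      ring
    have h2 := hmax y hy0
    rw [integral_const_mul, integral_sub hai (hFi c), inv_mul_le_iff₀ hε.1]
    have h3 : n * y - n * c = ε * (n * (x - c)) := by rw [hy]; ring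
    linarith
  have hlim : Filter.Tendsto (fun ε => ∫ t, ε⁻¹ * (B (a ε t) - B (F c t)) ∂ν)
      (nhdsWithin 0 (Ioi 0)) (nhds (∫ t, n * D (F c t) * (F x t - F c t) ∂ν)) := by
    have hsmall : ∀ᶠ ε in nhdsWithin (0 : ℝ) (Ioi 0), ε ∈ Ioo (0 : ℝ) 1 :=
      Ioo_mem_nhdsGT one_pos
    refine tendsto_integral_filter_of_dominated_convergence (fun _ => n * L) ?_ ?_
      (integrable_const _) ?_
    · exact .of_forall fun ε => ((hBc.comp_aestronglyMeasurable (ham ε)).sub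
        (hBc.comp_aestronglyMeasurable (hFm c))).const_mul _
    · filter_upwards [hsmall] with ε hε
      filter_upwards [hF01, ha] with t ht hat
      have h1 := (convex_Icc (0 : ℝ) 1).norm_image_sub_le_of_norm_hasDerivWithin_le
        (f := B) (f' := fun s => n * D s) (C := n * L)
        (fun s _ => (hB s).hasDerivWithinAt) (fun s hs => by
          rw [norm_mul, Real.norm_of_nonneg hn.le]
          exact mul_le_mul_of_nonneg_left (hL s hs) hn.le) (ht c) (hat ε hε)
      have h2 : ‖a ε t - F c t‖ ≤ ε := by
        simp only [a, add_sub_cancel_left, norm_mul, Real.norm_eq_abs, abs_of_pos hε.1]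
        refine mul_le_of_le_one_right hε.1.le (abs_le.2 ⟨?_, ?_⟩)
        · linarith [(ht x).1, (ht c).2]
        · linarith [(ht x).2, (ht c).1]
      have hnL : 0 ≤ n * L := mul_nonneg hn.le ((norm_nonneg _).trans (hL _ (ht c)))
      rw [norm_mul, norm_inv, Real.norm_of_nonneg hε.1.le, inv_mul_le_iff₀ hε.1, mul_comm ε]
      exact h1.trans (mul_le_mul_of_nonneg_left h2 hnL)
    · refine .of_forall fun t => ?_
      have h1 : HasDerivAt (fun ε => B (a ε t)) (n * D (F c t) * (F x t - F c t)) 0 := by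
        have h2 : HasDerivAt (fun ε => a ε t) (F x t - F c t) 0 := by
          have := ((hasDerivAt_id' (0 : ℝ)).mul_const (F x t - F c t)).const_add (F c t)
          rwa [one_mul] at this
        have h3 : a 0 t = F c t := by simp [a]
        exact HasDerivAt.comp (h₂ := B) 0 (by rw [h3]; exact hB _) h2
      have h4 := h1.tendsto_slope_zero_right
      simpa [a] using h4
  have h := le_of_tendsto hlim (by
    filter_upwards [Ioo_mem_nhdsGT one_pos] with ε hε using hquot ε hε)
  have h2 : ∫ t, n * D (F c t) * (F x t - F c t) ∂ν =
      n * ∫ t, (F x t - F c t) * D (F c t) ∂ν := by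
    rw [← integral_const_mul]
    exact integral_congr_ae (.of_forall fun t => by ring)
  rw [h2] at h
  exact le_of_mul_le_mul_left h hn

/-- At the best common effort `c`, this effort is the unique best response of each agent. If his
signal has some value, then his payoff is strictly concave, and otherwise `c = 0`. -/
theorem best_response_unique (hn : 0 < n) (hB : ∀ s, HasDerivAt B (n * D s) s)
    (hD : ∀ s ∈ Icc (0 : ℝ) 1, 0 ≤ D s) (hDc : Continuous D)
    (hF01 : ∀ᵐ t ∂ν, ∀ c, F c t ∈ Icc (0 : ℝ) 1)
    (hFm : ∀ c, AEStronglyMeasurable (F c) ν)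
    (hFconc : ∀ᵐ t ∂ν, StrictConcaveOn ℝ (Ici 0) fun c => F c t) {c : ℝ} (hc : 0 ≤ c)
    (hmax : ∀ c' ≥ 0, ∫ t, B (F c' t) ∂ν - n * c' ≤ ∫ t, B (F c t) ∂ν - n * c)
    {x : ℝ} (hx : 0 ≤ x) (hne : x ≠ c) :
    ∫ t, F x t * D (F c t) ∂ν - x < ∫ t, F c t * D (F c t) ∂ν - c := by
  obtain ⟨L, hL⟩ := isCompact_Icc.exists_bound_of_continuousOn (s := Icc (0 : ℝ) 1)
    hDc.continuousOn
  have hint : ∀ y, Integrable (fun t => F y t * D (F c t)) ν := fun y =>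
    Integrable.of_bound ((hFm y).mul (hDc.comp_aestronglyMeasurable (hFm c))) L (by
      filter_upwards [hF01] with t ht
      rw [norm_mul, Real.norm_of_nonneg (ht y).1]
      exact (mul_le_of_le_one_left (norm_nonneg _) (ht y).2).trans (hL _ (ht c)))
  have hfoc : ∀ y ≥ 0, ∫ t, F y t * D (F c t) ∂ν - ∫ t, F c t * D (F c t) ∂ν ≤ y - c := by
    intro y hy
    have := first_order_condition hn hB hD hDc hF01 hFm
      (hFconc.mono fun t ht => ht.concaveOn) hc hmax hy
    simp only [sub_mul] at this
    rwa [integral_sub (hint y) (hint c)] at this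
  by_cases hD0 : ∀ᵐ t ∂ν, D (F c t) = 0
  · have hz : ∀ y, ∫ t, F y t * D (F c t) ∂ν = 0 := fun y =>
      integral_eq_zero_of_ae (hD0.mono fun t ht => by simp [ht])
    have h0 := hfoc 0 le_rfl
    simp only [hz] at h0 ⊢
    have hc0 : c = 0 := by linarith
    subst hc0
    have := lt_of_le_of_ne hx hne.symm
    linarith
  · set m : ℝ := (1 / 2) * x + (1 / 2) * c with hm
    have hm0 : 0 ≤ m := by positivity
    have hlt : ∫ t, ((1 / 2) * (F x t * D (F c t)) + (1 / 2) * (F c t * D (F c t))) ∂ν <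
        ∫ t, F m t * D (F c t) ∂ν := by
      have hI := ((hint x).const_mul (1 / 2)).add ((hint c).const_mul (1 / 2))
      have hconc : ∀ᵐ t ∂ν, (1 / 2) * F x t + (1 / 2) * F c t < F m t := by
        filter_upwards [hFconc] with t ht
        have := ht.2 (mem_Ici.2 hx) (mem_Ici.2 hc) hne (one_half_pos (α := ℝ))
          (one_half_pos (α := ℝ)) (by norm_num)
        simpa only [smul_eq_mul] using this
      have hle : ∀ᵐ t ∂ν, (1 / 2) * (F x t * D (F c t)) + (1 / 2) * (F c t * D (F c t)) ≤
          F m t * D (F c t) := by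
        filter_upwards [hconc, hF01] with t ht h01
        have := mul_le_mul_of_nonneg_right ht.le (hD _ (h01 c))
        linarith
      refine lt_of_le_of_ne (integral_mono_ae hI (hint m) hle) fun heq => hD0 ?_
      filter_upwards [(integral_eq_iff_of_ae_le hI (hint m) hle).1 heq, hconc] with t h1 h2
      by_contra hne0
      refine h2.ne (mul_right_cancel₀ hne0 ?_)
      rw [← h1, Pi.add_apply]
      ring
    rw [integral_add ((hint x).const_mul _) ((hint c).const_mul _), integral_const_mul,
      integral_const_mul] at hlt
    have := hfoc m hm0
    rw [hm] at this
    linarith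

end Optimum

/-! ### The expected value of information -/

section InformationValue

variable {n : ℕ} {𝒴 𝒳 : Type*} [Fintype 𝒴] [Fintype 𝒳]

/-- The expected score of the posterior given the signals of the agents in `A`. -/
noncomputable def infoValue (M : Model 𝒴 𝒳) (A : Finset (Fin n)) : ℝ :=
  ∑ y, ∑ x, jointProb M y x * M.score (posterior M A x) y

/-- More signals do not make the expected score smaller. -/
lemma monotone_infoValue {M : Model 𝒴 𝒳} (hscore : StrictlyProper M.score) :
    Monotone (infoValue (n := n) M) := by
  intro A A' h
  have hpost : ∀ A : Finset (Fin n), A ⊆ A' → ∀ x x', (∀ j ∈ A', x j = x' j) →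
      posterior M A x = posterior M A x' := by
    intro A hA x x' hx
    rw [posterior, posterior, Finset.prod_congr rfl fun j hj => by rw [hx j (hA hj)]]
  have key := sum_jointProb_mul_eq M A'
    (fun y x => M.score (posterior M A' x) y - M.score (posterior M A x) y) fun y x x' hx => by
      rw [hpost A' subset_rfl x x' hx, hpost A h x x' hx]
  rw [← sub_nonneg]
  simp only [infoValue, ← Finset.sum_sub_distrib, ← mul_sub]
  rw [key]
  refine Finset.sum_nonneg fun y _ => Finset.sum_nonneg fun x _ =>
    mul_nonneg (jointProb_nonneg M y x) ?_
  simp only [mul_sub, Finset.sum_sub_distrib]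
  exact sub_nonneg.2 (hscore.1 _ _)

/-- As the signals are exchangeable, only the number of signals matters. -/
lemma infoValue_map (M : Model 𝒴 𝒳) (e : Equiv.Perm (Fin n)) (A : Finset (Fin n)) :
    infoValue M (A.map e.toEmbedding) = infoValue M A := by
  refine Finset.sum_congr rfl fun y _ => ?_
  refine Fintype.sum_equiv (Equiv.arrowCongr e.symm (Equiv.refl 𝒳)) _ _ fun x => ?_
  have h1 : jointProb M y (Equiv.arrowCongr e.symm (Equiv.refl 𝒳) x) = jointProb M y x := by
    simp only [jointProb, Equiv.arrowCongr_apply, Function.comp_apply, Equiv.symm_symm,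
      Equiv.refl_apply]
    rw [Equiv.prod_comp e fun j => (M.signal y (x j)).toReal]
  have h2 : posterior M A (Equiv.arrowCongr e.symm (Equiv.refl 𝒳) x) =
      posterior M (A.map e.toEmbedding) x := by
    simp [posterior, Finset.prod_map]
  rw [h1, h2]

end InformationValue

/-! ### Expectations under truthful and timely reports -/

section Expectation

variable {n : ℕ} {𝒴 𝒳 : Type*} [Fintype 𝒴] [MeasurableSpace 𝒳] {M : Model 𝒴 𝒳}

/-- The joint law of the seed and the arrival time of an agent with strategy `s`. -/
noncomputable def seedArrivalLaw (M : Model 𝒴 𝒳) (s : Strategy n 𝒴 𝒳) :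
    Measure (unitInterval × ℝ≥0∞) :=
  (volume : Measure unitInterval).compProd (M.latency.comap s.effort s.measurable_effort)

instance [IsMarkovKernel M.latency] (s : Strategy n 𝒴 𝒳) :
    IsProbabilityMeasure (seedArrivalLaw M s) := by
  unfold seedArrivalLaw; infer_instance

/-- The probability that the signal of an agent with strategy `s` arrives before time `t`. -/
noncomputable def arrivalProb (M : Model 𝒴 𝒳) (s : Strategy n 𝒴 𝒳) (t : ℝ) : ℝ :=
  (seedArrivalLaw M s).real {b | b.2 < ENNReal.ofReal t}

lemma measurableSet_snd_lt (t : ℝ) :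
    MeasurableSet {b : unitInterval × ℝ≥0∞ | b.2 < ENNReal.ofReal t} :=
  measurableSet_lt measurable_snd measurable_const

lemma arrivalProb_mem_Icc [IsMarkovKernel M.latency] (s : Strategy n 𝒴 𝒳) (t : ℝ) :
    arrivalProb M s t ∈ Icc (0 : ℝ) 1 :=
  ⟨measureReal_nonneg, measureReal_le_one⟩

lemma measureReal_arrived_eq [IsMarkovKernel M.latency] (σ : Profile n 𝒴 𝒳) (t : ℝ)
    (A : Finset (Fin n)) :
    (arrivalLaw M σ).real {b | arrived t b = A} =
      subsetProb (fun j => arrivalProb M (σ j) t) A := by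
  have hset : {b : Fin n → unitInterval × ℝ≥0∞ | arrived t b = A} =
      univ.pi fun j => if j ∈ A then {b | b.2 < ENNReal.ofReal t}
        else {b | b.2 < ENNReal.ofReal t}ᶜ := by
    ext b
    simp only [mem_ofPred_eq, Finset.ext_iff, mem_arrived, mem_pi, mem_univ, true_imp_iff]
    refine forall_congr' fun j => ?_
    by_cases h : j ∈ A <;> simp [h]
  rw [hset, measureReal_def, arrivalLaw]
  rw [Measure.pi_pi, ENNReal.toReal_prod, subsetProb]
  refine Finset.prod_congr rfl fun j _ => ?_
  split_ifs
  · rfl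
  · exact probReal_compl_eq_one_sub (μ := seedArrivalLaw M (σ j)) (measurableSet_snd_lt t)

lemma integral_arrived [IsMarkovKernel M.latency] (σ : Profile n 𝒴 𝒳) (t : ℝ)
    (f : Finset (Fin n) → ℝ) :
    ∫ b, f (arrived t b) ∂arrivalLaw M σ = expected f fun j => arrivalProb M (σ j) t := by
  classical
  have hms : ∀ A, MeasurableSet {b : Fin n → unitInterval × ℝ≥0∞ | arrived t b = A} := fun A =>
    (measurableSet_arrived_eq A).preimage (measurable_prodMk_left (x := t))
  have h : ∀ b : Fin n → unitInterval × ℝ≥0∞, f (arrived t b) =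
      ∑ A, {b | arrived t b = A}.indicator (fun _ => f A) b := fun b => by
    simp [indicator_apply]
  simp only [h]
  rw [integral_finsetSum _ fun A _ => (integrable_const _).indicator (hms A), expected]
  refine Finset.sum_congr rfl fun A _ => ?_
  rw [integral_indicator_const _ (hms A), measureReal_arrived_eq, smul_eq_mul]

section Discrete

variable [MeasurableSpace 𝒴] [Fintype 𝒳] [DiscreteMeasurableSpace 𝒳]

lemma map_seed_law [IsMarkovKernel M.latency] (σ : Profile n 𝒴 𝒳) (i : Fin n) :
    (law M σ).map (fun ω => (ω.2 i).2.1) = volume := by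
  have hs : Measurable fun ω : World n 𝒴 𝒳 => (ω.2 i).2.1 :=
    measurable_fst.comp (measurable_snd.comp ((measurable_pi_apply i).comp measurable_snd))
  refine Measure.ext_of_lintegral _ fun f hf => ?_
  have hfs : Measurable fun ω : World n 𝒴 𝒳 => f (ω.2 i).2.1 := hf.comp hs
  rw [lintegral_map hf hs, lintegral_law M σ hfs]
  simp only [← Finset.sum_mul, sum_ofReal_jointProb, one_mul]
  have h1 : MeasurePreserving (Function.eval i) (arrivalLaw M σ) (seedArrivalLaw M (σ i)) :=
    measurePreserving_eval (fun i => seedArrivalLaw M (σ i)) i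
  rw [h1.lintegral_comp (f := fun b => f b.1) (hf.comp measurable_fst)]
  have h2 : (seedArrivalLaw M (σ i)).map Prod.fst = volume := Measure.fst_compProd _ _
  rw [← lintegral_map hf measurable_fst, h2]

variable [DiscreteMeasurableSpace 𝒴]

lemma measurable_arrived_signals (f : Finset (Fin n) → (Fin n → 𝒳) → 𝒴 → ℝ) :
    Measurable fun a : World n 𝒴 𝒳 × ℝ =>
      f (arrived a.2 (arrivals a.1.2)) (signals a.1.2) a.1.1 := by
  let _ : MeasurableSpace (Finset (Fin n)) := ⊤
  have h1 : Measurable fun a : World n 𝒴 𝒳 × ℝ => arrived a.2 (arrivals a.1.2) :=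
    (measurable_comp_arrived id).comp
      (f := fun a : World n 𝒴 𝒳 × ℝ => (a.2, arrivals a.1.2))
      (measurable_snd.prodMk (measurable_pi_lambda _ fun j => measurable_snd.comp
        ((measurable_pi_apply j).comp (measurable_snd.comp measurable_fst))))
  have h2 : Measurable fun a : World n 𝒴 𝒳 × ℝ => signals a.1.2 :=
    measurable_pi_lambda _ fun j => measurable_fst.comp
      ((measurable_pi_apply j).comp (measurable_snd.comp measurable_fst))
  have h3 : Measurable fun a : Finset (Fin n) × (Fin n → 𝒳) × 𝒴 => f a.1 a.2.1 a.2.2 :=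
    measurable_of_countable _
  exact h3.comp (h1.prodMk (h2.prodMk (measurable_fst.comp measurable_fst)))

/-- The expected score over time, if at each time the belief is the posterior given some of the
signals that have arrived, selected by `φ`. -/
lemma integral_score_posterior [IsMarkovKernel M.latency] [IsFiniteMeasure (timeMeasure M)]
    (σ : Profile n 𝒴 𝒳) (φ : Finset (Fin n) → Finset (Fin n)) :
    Integrable (fun ω : World n 𝒴 𝒳 => ∫ t, M.score
      (posterior M (φ (arrived t (arrivals ω.2))) (signals ω.2)) ω.1 ∂timeMeasure M)
      (law M σ) ∧
    ∫ ω, ∫ t, M.score (posterior M (φ (arrived t (arrivals ω.2))) (signals ω.2)) ω.1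
      ∂timeMeasure M ∂law M σ =
      ∫ t, expected (fun A => infoValue M (φ A)) (fun j => arrivalProb M (σ j) t)
        ∂timeMeasure M := by
  obtain ⟨C, hC⟩ := exists_abs_score_posterior_le (n := n) M
  have hm := measurable_arrived_signals (𝒴 := 𝒴) (𝒳 := 𝒳) (n := n)
    fun A x y => M.score (posterior M (φ A) x) y
  have hint : Integrable (fun a : World n 𝒴 𝒳 × ℝ =>
      M.score (posterior M (φ (arrived a.2 (arrivals a.1.2))) (signals a.1.2)) a.1.1)
      ((law M σ).prod (timeMeasure M)) :=
    Integrable.of_bound hm.aestronglyMeasurable C (.of_forall fun a => hC _ _ _)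
  refine ⟨hint.integral_prod_left, ?_⟩
  rw [integral_integral_swap hint]
  refine integral_congr_ae (.of_forall fun t => ?_)
  have hmt : Measurable fun ω : World n 𝒴 𝒳 =>
      M.score (posterior M (φ (arrived t (arrivals ω.2))) (signals ω.2)) ω.1 :=
    hm.comp (f := fun ω => (ω, t)) measurable_prodMk_right
  simp only
  rw [← integral_arrived σ t fun A => infoValue M (φ A), integral_law M σ hmt fun ω => hC _ _ _]
  rfl

/-- The expected value of information, if reports are truthful and timely. -/
lemma integral_value_truthful [IsMarkovKernel M.latency] [IsFiniteMeasure (timeMeasure M)]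
    (hpos : ∀ t > 0, 0 < M.weight t) (hint : IntegrableOn M.weight (Ioi 0))
    (σ : Profile n 𝒴 𝒳) (c : ℝ≥0) :
    Integrable (fun ω : World n 𝒴 𝒳 =>
      value M.prior M.score M.weight (play (fun _ => truthfulTimely n M c) ω.2) ω.1)
      (law M σ) ∧
    ∫ ω, value M.prior M.score M.weight (play (fun _ => truthfulTimely n M c) ω.2) ω.1
      ∂law M σ =
      ∫ t, expected (infoValue M) (fun j => arrivalProb M (σ j) t) ∂timeMeasure M := by
  simp only [value, integral_timeMeasure hpos hint, marketBelief_truthful]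
  exact integral_score_posterior σ id

/-- The expected reward of agent `i`, if reports are truthful and timely. -/
lemma integral_reward_truthful [IsMarkovKernel M.latency] [IsFiniteMeasure (timeMeasure M)]
    (hpos : ∀ t > 0, 0 < M.weight t) (hint : IntegrableOn M.weight (Ioi 0))
    (hmeas : ∀ y, Measurable fun p => M.score p y)
    (σ : Profile n 𝒴 𝒳) (c : ℝ≥0) (i : Fin n) :
    Integrable (fun ω : World n 𝒴 𝒳 =>
      reward M.prior M.score M.weight (play (fun _ => truthfulTimely n M c) ω.2) i ω.1)
      (law M σ) ∧
    ∫ ω, reward M.prior M.score M.weight (play (fun _ => truthfulTimely n M c) ω.2) i ω.1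
      ∂law M σ =
      ∫ t, expected (fun A => infoValue M A - infoValue M (A.erase i))
        (fun j => arrivalProb M (σ j) t) ∂timeMeasure M := by
  classical
  obtain ⟨h1, h1'⟩ := integral_score_posterior (M := M) σ id
  obtain ⟨h2, h2'⟩ := integral_score_posterior (M := M) σ fun A => A.erase i
  have hr : ∀ ω : World n 𝒴 𝒳,
      reward M.prior M.score M.weight (play (fun _ => truthfulTimely n M c) ω.2) i ω.1 =
      (∫ t, M.score (posterior M (id (arrived t (arrivals ω.2))) (signals ω.2)) ω.1
        ∂timeMeasure M) -
      ∫ t, M.score (posterior M ((arrived t (arrivals ω.2)).erase i) (signals ω.2)) ω.1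
        ∂timeMeasure M := by
    intro ω
    have h3 := integrable_score_beliefFrom (M := M) hmeas
      (play (fun _ => truthfulTimely n M c) ω.2) Finset.univ ω.1
    have h4 := integrable_score_beliefFrom (M := M) hmeas
      (play (fun _ => truthfulTimely n M c) ω.2) (Finset.univ.erase i) ω.1
    have h5 := fun t => marketBelief_truthful M c ω.2 t
    have h6 := fun t => counterfactualBelief_truthful M c i ω.2 t
    simp only [marketBelief, counterfactualBelief] at h5 h6
    simp only [reward, integral_timeMeasure hpos hint, marketBelief, counterfactualBelief]
    rw [integral_sub h3 h4]
    simp only [h5, h6, id]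
  have hE : ∀ g : Fin n → ℝ, expected (fun A => infoValue M A - infoValue M (A.erase i)) g =
      expected (fun A => infoValue M (id A)) g - expected (fun A => infoValue M (A.erase i)) g := by
    intro g
    simp only [expected, mul_sub, Finset.sum_sub_distrib, id]
  have hexp : ∀ φ : Finset (Fin n) → Finset (Fin n), Integrable (fun t =>
      expected (fun A => infoValue M (φ A)) fun j => arrivalProb M (σ j) t) (timeMeasure M) := by
    intro φ
    obtain ⟨C, hC⟩ := (Set.finite_range fun A => |infoValue M (φ A)|).bddAbove
    refine Integrable.of_bound (Measurable.aestronglyMeasurable ?_) C (.of_forall fun t =>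
      abs_expected_le (fun A => hC ⟨A, rfl⟩) fun j => arrivalProb_mem_Icc _ _)
    simp only [← integral_arrived]
    exact (measurable_comp_arrived fun A =>
      infoValue M (φ A)).stronglyMeasurable.integral_prod_right.measurable
  simp only [hr, hE]
  refine ⟨h1.sub h2, ?_⟩
  rw [integral_sub h1 h2, h1', h2', integral_sub (hexp _) (hexp _)]

end Discrete

end Expectation

/-! ### The probability of arrival as a function of the effort -/

section Latency

variable {n : ℕ} {𝒴 𝒳 : Type*} [Fintype 𝒴] {M : Model 𝒴 𝒳}

lemma cdf_mem_Icc [IsMarkovKernel M.latency] (c t : ℝ) : cdf M c t ∈ Icc (0 : ℝ) 1 :=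
  ⟨ENNReal.toReal_nonneg, measureReal_le_one (μ := M.latency c.toNNReal)⟩

lemma measurable_cdf [IsMarkovKernel M.latency] :
    Measurable fun a : ℝ × ℝ => cdf M a.1 a.2 := by
  have hs : MeasurableSet {p : (ℝ × ℝ) × ℝ≥0∞ | p.2 ≤ ENNReal.ofReal p.1.2} :=
    measurableSet_le measurable_snd (measurable_snd.comp measurable_fst).ennreal_ofReal
  have hf : Measurable fun a : ℝ × ℝ => a.1.toNNReal := measurable_fst.real_toNNReal
  exact (Kernel.measurable_kernel_prodMk_left (κ := M.latency.comap _ hf) hs).ennreal_toReal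

lemma strictConcaveOn_cdf
    (hcont : ∀ t > 0, ContinuousOn (fun c => cdf M c t) (Ici 0))
    (hderiv : ∀ t > 0, ∀ c > 0, deriv (deriv fun c => cdf M c t) c < 0) {t : ℝ} (ht : 0 < t) :
    StrictConcaveOn ℝ (Ici 0) fun c => cdf M c t := by
  refine strictConcaveOn_of_deriv2_neg (convex_Ici 0) (hcont t ht) fun c hc => ?_
  rw [interior_Ici] at hc
  exact hderiv t ht c hc

variable [MeasurableSpace 𝒳]

/-- At almost every time the probability that the signal has arrived before it is an average of
the c.d.f. over the random effort. The exceptions are the atoms of the law of the arrival time. -/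
lemma ae_arrivalProb_eq [IsMarkovKernel M.latency] (s : Strategy n 𝒴 𝒳) :
    ∀ᵐ t ∂timeMeasure M, arrivalProb M s t = ∫ u, cdf M (s.effort u) t := by
  have hatoms : ∀ᵐ t ∂timeMeasure M,
      seedArrivalLaw M s {b | b.2 = ENNReal.ofReal t} = 0 := by
    have hc := Measure.countable_meas_level_set_pos (μ := seedArrivalLaw M s)
      (g := fun b => b.2) measurable_snd
    have hc' : (Ioi (0 : ℝ) ∩ ENNReal.ofReal ⁻¹'
        {τ | 0 < seedArrivalLaw M s {b | b.2 = τ}}).Countable := by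
      refine Set.Countable.mono (s₂ := ENNReal.toReal ''
        {τ | 0 < seedArrivalLaw M s {b | b.2 = τ}}) ?_ (hc.image _)
      intro t ht
      exact ⟨ENNReal.ofReal t, ht.2, ENNReal.toReal_ofReal ht.1.le⟩
    have hnull := timeMeasure_absolutelyContinuous M (hc'.measure_zero volume)
    filter_upwards [measure_eq_zero_iff_ae_notMem.1 hnull, ae_timeMeasure_pos M] with t h1 h2
    by_contra h3
    exact h1 ⟨h2, pos_iff_ne_zero.2 h3⟩
  filter_upwards [hatoms] with t ht
  have hms : MeasurableSet {b : unitInterval × ℝ≥0∞ | b.2 ≤ ENNReal.ofReal t} :=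
    measurableSet_le measurable_snd measurable_const
  have h1 : seedArrivalLaw M s {b | b.2 < ENNReal.ofReal t} =
      seedArrivalLaw M s {b | b.2 ≤ ENNReal.ofReal t} := by
    refine le_antisymm (measure_mono fun b hb => (le_of_lt hb : b.2 ≤ _)) ?_
    have : {b : unitInterval × ℝ≥0∞ | b.2 ≤ ENNReal.ofReal t} ⊆
        {b | b.2 < ENNReal.ofReal t} ∪ {b | b.2 = ENNReal.ofReal t} := fun b hb =>
      (lt_or_eq_of_le hb : b.2 < _ ∨ b.2 = _)
    refine (measure_mono this).trans ((measure_union_le _ _).trans ?_)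
    rw [ht, add_zero]
  rw [arrivalProb, measureReal_def, h1, seedArrivalLaw, Measure.compProd_apply hms]
  have hk : Measurable fun u => M.latency (s.effort u) (Iic (ENNReal.ofReal t)) :=
    (Kernel.measurable_coe M.latency measurableSet_Iic).comp s.measurable_effort
  have h2 : ∀ u, cdf M (s.effort u) t =
      (M.latency (s.effort u) (Iic (ENNReal.ofReal t))).toReal := fun u => by
    rw [cdf, Real.toNNReal_coe]
  simp only [h2]
  rw [integral_toReal hk.aemeasurable (.of_forall fun u => measure_lt_top _ _)]
  rfl

lemma ae_arrivalProb_truthfulTimely_eq [MeasurableSpace 𝒴] [DiscreteMeasurableSpace 𝒳]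
    [Countable 𝒳] [IsMarkovKernel M.latency] (c : ℝ≥0) :
    ∀ᵐ t ∂timeMeasure M, arrivalProb M (truthfulTimely n M c) t = cdf M c t := by
  filter_upwards [ae_arrivalProb_eq (truthfulTimely n M c)] with t ht
  rw [ht]
  simp [truthfulTimely]

lemma integrable_cdf_effort [IsMarkovKernel M.latency] (s : Strategy n 𝒴 𝒳) (t : ℝ) :
    Integrable fun u => cdf M (s.effort u) t :=
  Integrable.of_bound (measurable_cdf.comp
    (f := fun u => ((s.effort u : ℝ), t)) (s.measurable_effort.coe_nnreal_real.prodMk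
      measurable_const)).aestronglyMeasurable 1 (.of_forall fun u => by
    rw [Real.norm_of_nonneg (cdf_mem_Icc _ _).1]
    exact (cdf_mem_Icc _ _).2)

/-- By concavity, a random effort does not make early arrival more likely than its mean. -/
lemma ae_arrivalProb_le [IsMarkovKernel M.latency]
    (hcont : ∀ t > 0, ContinuousOn (fun c => cdf M c t) (Ici 0))
    (hderiv : ∀ t > 0, ∀ c > 0, deriv (deriv fun c => cdf M c t) c < 0) (s : Strategy n 𝒴 𝒳)
    (hs : Integrable fun u => (s.effort u : ℝ)) :
    ∀ᵐ t ∂timeMeasure M, arrivalProb M s t ≤ cdf M (∫ u, (s.effort u : ℝ)) t := by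
  filter_upwards [ae_arrivalProb_eq s, ae_timeMeasure_pos M] with t h1 h2
  rw [h1]
  exact (strictConcaveOn_cdf hcont hderiv h2).concaveOn.le_map_integral (hcont t h2) isClosed_Ici
    (.of_forall fun u => (s.effort u).2) hs (integrable_cdf_effort s t)

end Latency

/-! ### Individual rationality -/

section IndividualRationality

variable {n : ℕ} {𝒴 𝒳 : Type*}

/-- The strategy of investing nothing and not reporting. -/
def abstain (n : ℕ) (𝒴 𝒳 : Type*) [MeasurableSpace 𝒳] : Strategy n 𝒴 𝒳 where
  effort _ := 0
  early _ := noRecord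
  late _ := noRecord
  measurable_effort := measurable_const
  measurable_early := measurable_const
  measurable_late := measurable_const

lemma nextReport_abstain [MeasurableSpace 𝒳] (w : Private 𝒳) (H : History n 𝒴) :
    (nextReport (abstain n 𝒴 𝒳) w H).1 = ∞ := by
  simp [nextReport, abstain, noRecord]

lemma reward_of_noRecord [Fintype 𝒴] (M : Model 𝒴 𝒳) {H : History n 𝒴} {i : Fin n} (h : H i = noRecord)
    (y : 𝒴) : reward M.prior M.score M.weight H i y = 0 := by
  classical
  have : ∀ t, marketBelief M.prior H t = counterfactualBelief M.prior H i t := fun t => by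
    rw [marketBelief, counterfactualBelief, beliefFrom_eq, beliefFrom_eq,
      ← Finset.mul_prod_erase _ _ (Finset.mem_univ i), h]
    simp [noRecord]
  simp [reward, this]

/-- An agent can secure the payoff zero. -/
theorem individuallyRational [Fintype 𝒴] [MeasurableSpace 𝒴] [MeasurableSpace 𝒳]
    (M : Model 𝒴 𝒳) :
    IndividuallyRational n M := by
  intro σ hσ i
  have h0 : payoff M (deviate σ i (abstain n 𝒴 𝒳)) i = fun _ => 0 := by
    funext ω
    have hi : deviate σ i (abstain n 𝒴 𝒳) i = abstain n 𝒴 𝒳 := Function.update_self ..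
    rw [payoff, reward_of_noRecord M (play_of_never fun H => by rw [hi, nextReport_abstain]), hi]
    simp [abstain]
  have h := (hσ i).2 (abstain n 𝒴 𝒳)
  rw [utility, h0] at h
  simpa using h (integrable_zero _ _ _)

end IndividualRationality

/-! ### The best response to truthful and timely agents -/

section BestResponse

variable {n : ℕ} {𝒴 𝒳 : Type*} [MeasurableSpace 𝒴] [MeasurableSpace 𝒳]

lemma measurable_effort_seed (s : Strategy n 𝒴 𝒳) (i : Fin n) :
    Measurable fun ω : World n 𝒴 𝒳 => (s.effort (ω.2 i).2.1 : ℝ) :=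
  (s.measurable_effort.comp (measurable_fst.comp (measurable_snd.comp
    ((measurable_pi_apply i).comp measurable_snd)))).coe_nnreal_real

variable [Fintype 𝒴] [Fintype 𝒳] [DiscreteMeasurableSpace 𝒳] {M : Model 𝒴 𝒳}

/-- The payoff of agent `i` after a deviation compares with that of reporting truthfully and
timely, but with the efforts of the deviation, like the losses do. -/
lemma payoff_deviate_compare [DiscreteMeasurableSpace 𝒴] [IsFiniteMeasure (timeMeasure M)]
    (hscore : StrictlyProper M.score)
    (hmeas : ∀ y, Measurable fun p => M.score p y) (hpos : ∀ t > 0, 0 < M.weight t)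
    (hint : IntegrableOn M.weight (Ioi 0)) (c : ℝ≥0) (i : Fin n) (τ : Strategy n 𝒴 𝒳)
    {μ : Measure (World n 𝒴 𝒳)} [IsFiniteMeasure μ]
    (hμ : Integrable (payoff M (deviate (fun _ => truthfulTimely n M c) i τ) i) μ) :
    let σ : Profile n 𝒴 𝒳 := fun _ => truthfulTimely n M c
    let f : World n 𝒴 𝒳 → ℝ := fun ω =>
      reward M.prior M.score M.weight (play σ ω.2) i ω.1 - τ.effort (ω.2 i).2.1
    Integrable (fun ω : World n 𝒴 𝒳 => (τ.effort (ω.2 i).2.1 : ℝ)) μ ∧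
    (∫⁻ ω, lossOf M σ ω ∂μ ≤ ∫⁻ ω, lossOf M (deviate σ i τ) ω ∂μ →
      ∫ ω, payoff M (deviate σ i τ) i ω ∂μ ≤ ∫ ω, f ω ∂μ) ∧
    (∫⁻ ω, lossOf M σ ω ∂μ < ∫⁻ ω, lossOf M (deviate σ i τ) ω ∂μ →
      ∫ ω, payoff M (deviate σ i τ) i ω ∂μ < ∫ ω, f ω ∂μ) := by
  intro σ f
  obtain ⟨C, hC⟩ := exists_abs_counterfactualLoss_le (n := n) (M := M) c i
  obtain ⟨B, hB⟩ := exists_lossOf_truthful_le (n := n) (M := M) c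
  have hτ : deviate σ i τ i = τ := Function.update_self ..
  let a : World n 𝒴 𝒳 → ℝ := fun ω => counterfactualLoss M σ i ω - τ.effort (ω.2 i).2.1
  have hcm : Measurable (counterfactualLoss M σ i) := measurable_counterfactualLoss hmeas σ i
  have ham : Measurable a := hcm.sub (measurable_effort_seed τ i)
  have hpay : payoff M (deviate σ i τ) i =
      fun ω => a ω - (lossOf M (deviate σ i τ) ω).toReal := by
    funext ω
    rw [payoff, reward_eq hscore hmeas hpos hint, counterfactualLoss_deviate, hτ]
    simp only [a, σ]
    ring
  have hf : f = fun ω => a ω - (lossOf M σ ω).toReal := by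
    funext ω
    simp only [f, a]
    rw [reward_eq hscore hmeas hpos hint]
    ring
  rw [hpay] at hμ
  obtain ⟨h1, _, h3, h4⟩ := integral_sub_toReal_le (A := C) (B := B) ham
    (fun ω => (sub_le_self _ (NNReal.coe_nonneg _)).trans (abs_le.1 (hC ω)).2)
    (measurable_lossOf hmeas σ) hB (measurable_lossOf hmeas _) (lossOf_ne_top _) hμ
  rw [hpay, hf]
  refine ⟨?_, h3, h4⟩
  have hci : Integrable (counterfactualLoss M σ i) μ :=
    Integrable.of_bound hcm.aestronglyMeasurable C (.of_forall hC)
  refine (hci.sub h1).congr (.of_forall fun ω => ?_)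
  simp [a]

variable [IsMarkovKernel M.latency]

lemma integral_effort_seed (σ : Profile n 𝒴 𝒳) (s : Strategy n 𝒴 𝒳) (i : Fin n) :
    ∫ ω, (s.effort (ω.2 i).2.1 : ℝ) ∂law M σ = ∫ u, (s.effort u : ℝ) := by
  rw [← map_seed_law (M := M) σ i, integral_map]
  · exact (measurable_fst.comp (measurable_snd.comp
      ((measurable_pi_apply i).comp measurable_snd))).aemeasurable
  · exact s.measurable_effort.coe_nnreal_real.aestronglyMeasurable

lemma integrable_effort_of_seed (σ : Profile n 𝒴 𝒳) (s : Strategy n 𝒴 𝒳) (i : Fin n)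
    (h : Integrable (fun ω : World n 𝒴 𝒳 => (s.effort (ω.2 i).2.1 : ℝ)) (law M σ)) :
    Integrable fun u => (s.effort u : ℝ) := by
  rw [← map_seed_law (M := M) σ i, integrable_map_measure]
  · exact h
  · exact s.measurable_effort.coe_nnreal_real.aestronglyMeasurable
  · exact (measurable_fst.comp (measurable_snd.comp
      ((measurable_pi_apply i).comp measurable_snd))).aemeasurable

variable [DiscreteMeasurableSpace 𝒴] [IsFiniteMeasure (timeMeasure M)]

/-- The payoff of an agent with effort `x` when all reports are truthful and timely and the other
agents have effort `c`. -/
noncomputable def responsePayoff (M : Model 𝒴 𝒳) (i : Fin n) (c x : ℝ) : ℝ :=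
  ∫ t, cdf M x t * marginal (infoValue M) (fun _ => cdf M c t) i ∂timeMeasure M - x

/-- The expected payoff of agent `i` with a random effort, when all reports are truthful and timely
and the other agents have effort `c`. -/
lemma integral_reward_sub_effort (hmeas : ∀ y, Measurable fun p => M.score p y)
    (hpos : ∀ t > 0, 0 < M.weight t) (hint : IntegrableOn M.weight (Ioi 0)) (c : ℝ≥0) (i : Fin n)
    (τ : Strategy n 𝒴 𝒳) (hτ : Integrable fun u => (τ.effort u : ℝ))
    (hτ' : Integrable (fun ω : World n 𝒴 𝒳 => (τ.effort (ω.2 i).2.1 : ℝ))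
      (law M (deviate (fun _ => truthfulTimely n M c) i τ))) :
    Integrable (fun u => responsePayoff M i c (τ.effort u)) ∧
    ∫ ω, (reward M.prior M.score M.weight (play (fun _ => truthfulTimely n M c) ω.2) i ω.1 -
      τ.effort (ω.2 i).2.1) ∂law M (deviate (fun _ => truthfulTimely n M c) i τ) =
      ∫ u, responsePayoff M i c (τ.effort u) := by
  classical
  obtain ⟨h1, h2⟩ := integral_reward_truthful (M := M) hpos hint hmeas
    (deviate (fun _ => truthfulTimely n M c) i τ) c i
  set D : ℝ → ℝ := fun s => marginal (infoValue M) (fun _ => s) i with hD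
  have hDc : Continuous D := continuous_marginal_diag _ i
  obtain ⟨L, hL⟩ := isCompact_Icc.exists_bound_of_continuousOn (s := Icc (0 : ℝ) 1)
    hDc.continuousOn
  have hjm : Measurable fun a : unitInterval × ℝ => cdf M (τ.effort a.1) a.2 * D (cdf M c a.2) :=
    (measurable_cdf.comp (f := fun a : unitInterval × ℝ => ((τ.effort a.1 : ℝ), a.2))
      ((τ.measurable_effort.coe_nnreal_real.comp measurable_fst).prodMk measurable_snd)).mul
    (hDc.measurable.comp (measurable_cdf.comp (f := fun a : unitInterval × ℝ => ((c : ℝ), a.2))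
      (measurable_const.prodMk measurable_snd)))
  have hji : Integrable (fun a : unitInterval × ℝ =>
      cdf M (τ.effort a.1) a.2 * D (cdf M c a.2))
      ((volume : Measure unitInterval).prod (timeMeasure M)) := by
    refine Integrable.of_bound hjm.aestronglyMeasurable L (.of_forall fun a => ?_)
    rw [norm_mul, Real.norm_of_nonneg (cdf_mem_Icc _ _).1]
    exact (mul_le_of_le_one_left (norm_nonneg _) (cdf_mem_Icc _ _).2).trans
      (hL _ (cdf_mem_Icc _ _))
  have hI : Integrable fun u =>
      ∫ t, cdf M (τ.effort u) t * D (cdf M c t) ∂timeMeasure M := hji.integral_prod_left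
  refine ⟨hI.sub hτ, ?_⟩
  rw [integral_sub h1 hτ', h2, integral_effort_seed]
  simp only [responsePayoff]
  rw [integral_sub hI hτ, integral_integral_swap hji]
  congr 1
  refine integral_congr_ae ?_
  filter_upwards [ae_arrivalProb_eq τ, ae_arrivalProb_truthfulTimely_eq (n := n) (M := M) c]
    with t h3 h4
  have h5 : (fun j => arrivalProb M (deviate (fun _ => truthfulTimely n M c) i τ j) t) =
      Function.update (fun _ => cdf M c t) i (∫ u, cdf M (τ.effort u) t) := by
    funext j
    by_cases hj : j = i
    · subst hj
      simp [deviate, h3]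
    · simp [deviate, hj, h4]
  rw [h5, expected_update_sub, integral_mul_const]

/-- The expected value of information minus the total effort, if all agents have effort `c` and
are truthful and timely. -/
lemma welfare_truthfulTimely (hpos : ∀ t > 0, 0 < M.weight t)
    (hint : IntegrableOn M.weight (Ioi 0)) (c : ℝ≥0) :
    Integrable (surplus M fun _ : Fin n => truthfulTimely n M c)
      (law M fun _ : Fin n => truthfulTimely n M c) ∧
    welfare M (fun _ : Fin n => truthfulTimely n M c) =
      ∫ t, expected (infoValue (n := n) M) (fun _ => cdf M c t) ∂timeMeasure M - n * c := by
  obtain ⟨h1, h2⟩ := integral_value_truthful (M := M) hpos hint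
    (fun _ : Fin n => truthfulTimely n M c) c
  have hs : surplus M (fun _ : Fin n => truthfulTimely n M c) = fun ω =>
      value M.prior M.score M.weight (play (fun _ => truthfulTimely n M c) ω.2) ω.1 - n * c := by
    funext ω
    simp [surplus, truthfulTimely]
  rw [welfare, hs]
  refine ⟨h1.sub (integrable_const _), ?_⟩
  rw [integral_sub h1 (integrable_const _), h2, integral_const]
  simp only [probReal_univ, one_smul]
  congr 1
  refine integral_congr_ae ?_
  filter_upwards [ae_arrivalProb_truthfulTimely_eq (n := n) (M := M) c] with t ht
  simp only [ht]

end BestResponse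

/-! ### Equilibrium -/

section Equilibrium

lemma before_congr_of_le {n : ℕ} {𝒴 : Type*} {s t : ℝ≥0∞} (hst : t ≤ s) {H H' : History n 𝒴}
    (h : before s H = before s H') : before t H = before t H' := by
  have key : ∀ H : History n 𝒴, before t H = before t (before s H) := by
    intro H
    funext j
    simp only [before]
    by_cases h1 : (H j).1 < t
    · simp [h1, h1.trans_le hst]
    · by_cases h2 : (H j).1 < s <;> simp [h1, h2, noRecord]
  rw [key H, key H', h]

variable {n : ℕ} {𝒴 𝒳 : Type*} [Fintype 𝒴] [Fintype 𝒳] {M : Model 𝒴 𝒳}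

/-- If `c` is the best common effort, then it is the unique best response to itself. -/
lemma responsePayoff_lt [IsMarkovKernel M.latency] [IsFiniteMeasure (timeMeasure M)]
    (hscore : StrictlyProper M.score)
    (hcont : ∀ t > 0, ContinuousOn (fun c => cdf M c t) (Ici 0))
    (hderiv : ∀ t > 0, ∀ c > 0, deriv (deriv fun c => cdf M c t) c < 0) {c : ℝ} (hc : 0 ≤ c)
    (hmax : ∀ c' ≥ 0, ∫ t, expected (infoValue (n := n) M) (fun _ => cdf M c' t) ∂timeMeasure M -
      n * c' ≤ ∫ t, expected (infoValue (n := n) M) (fun _ => cdf M c t) ∂timeMeasure M - n * c)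
    (i : Fin n) {x : ℝ} (hx : 0 ≤ x) (hne : x ≠ c) :
    responsePayoff M i c x < responsePayoff M i c c := by
  have hn : (0 : ℝ) < n := Nat.cast_pos.2 i.pos
  have hB : ∀ s, HasDerivAt (fun s => expected (infoValue (n := n) M) fun _ => s)
      (n * marginal (infoValue M) (fun _ => s) i) s := by
    intro s
    convert hasDerivAt_expected_diag (infoValue (n := n) M) s using 1
    rw [Finset.sum_congr rfl fun k _ => marginal_const_eq (infoValue_map M) s k i]
    simp
  exact best_response_unique hn hB
    (fun s hs => marginal_nonneg (monotone_infoValue hscore) (fun _ => hs) i)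
    (continuous_marginal_diag _ i) (.of_forall fun t c => cdf_mem_Icc c t)
    (fun c => (measurable_cdf.comp (f := fun t => (c, t))
      measurable_prodMk_left).aestronglyMeasurable)
    ((ae_timeMeasure_pos M).mono fun t ht => strictConcaveOn_cdf hcont hderiv ht) hc hmax hx hne

/-- The best common effort exists. -/
lemma exists_optimal_common_effort [IsMarkovKernel M.latency]
    (hint : IntegrableOn M.weight (Ioi 0))
    (hcont : ∀ t > 0, ContinuousOn (fun c => cdf M c t) (Ici 0)) (n : ℕ) :
    ∃ c : ℝ≥0, ∀ c' ≥ 0,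
      ∫ t, expected (infoValue (n := n) M) (fun _ => cdf M c' t) ∂timeMeasure M - n * c' ≤
        ∫ t, expected (infoValue (n := n) M) (fun _ => cdf M c t) ∂timeMeasure M - n * c := by
  have := isFiniteMeasure_timeMeasure hint
  rcases Nat.eq_zero_or_pos n with rfl | hn
  · refine ⟨0, fun c' _ => le_of_eq ?_⟩
    have : ∀ g g' : Fin 0 → ℝ, expected (infoValue M) g = expected (infoValue M) g' :=
      fun g g' => by rw [Subsingleton.elim g g']
    simp only [this _ fun _ => 0]
    simp
  · have hc : Continuous fun s => expected (infoValue (n := n) M) fun _ => s :=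
      continuous_iff_continuousAt.2 fun s => (hasDerivAt_expected_diag _ s).continuousAt
    obtain ⟨c, hc0, hmax⟩ := exists_optimal_effort (ν := timeMeasure M) (F := cdf M)
      (B := fun s => expected (infoValue (n := n) M) fun _ => s) (n := n) (Nat.cast_pos.2 hn) hc
      (.of_forall fun t c => cdf_mem_Icc c t)
      (fun c => (measurable_cdf.comp (f := fun t => (c, t))
        measurable_prodMk_left).aestronglyMeasurable)
      ((ae_timeMeasure_pos M).mono fun t ht => hcont t ht)
    exact ⟨⟨c, hc0⟩, hmax⟩

variable [MeasurableSpace 𝒳] [DiscreteMeasurableSpace 𝒳]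

/-- What an agent observes up to a time before `t` is independent of the signals that have not
arrived before `t`. -/
lemma view_truthfulTimely_congr (c : ℝ≥0) (i : Fin n) {r t : ℝ≥0∞} (hr : r < t)
    {ω ω' : World n 𝒴 𝒳} (h : AgreeBefore t ω.2 ω'.2) :
    view (fun _ => truthfulTimely n M c) i r ω = view (fun _ => truthfulTimely n M c) i r ω' := by
  have hj : ∀ j, (ω.2 j).2.2 ≤ r → ω.2 j = ω'.2 j := fun j hj =>
    Prod.ext ((h j).2 (hj.trans_lt hr)) (h j).1
  have hp : ∀ (w : Fin n → Private 𝒳) j, play (fun _ => truthfulTimely n M c) w j =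
      if (w j).2.2 < ∞ then ((w j).2.2, likelihood M (w j).1) else noRecord := by
    intro w j
    rw [play_truthfulTimely M rfl]
  simp only [view]
  refine Prod.ext (by rw [(h i).1]) (Prod.ext ?_ ?_)
  · simp only [← (h i).1]
    split_ifs with h1
    · rw [hj i h1]
    · rfl
  · funext j
    simp only [upTo, hp, ← (h j).1]
    by_cases h1 : (ω.2 j).2.2 ≤ r
    · rw [hj j h1]
    · by_cases h2 : (ω.2 j).2.2 < ∞
      · simp [h1, h2]
      · simp [h2, noRecord]

variable [MeasurableSpace 𝒴] [DiscreteMeasurableSpace 𝒴] [IsMarkovKernel M.latency]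

/-- Truthful and timely reports with the best common effort are a strict perfect Bayesian
equilibrium. The counterfactual beliefs for the absence of an agent are out of his hands. So on
the way from the payoff after a deviation to the equilibrium payoff, replacing his reports by
truthful and timely ones reduces his expected loss, and then replacing his effort by the best
response raises his payoff further. -/
theorem isStrictPBE_truthfulTimely (hscore : StrictlyProper M.score)
    (hmeas : ∀ y, Measurable fun p => M.score p y) (hpos : ∀ t > 0, 0 < M.weight t)
    (hint : IntegrableOn M.weight (Ioi 0))
    (hcont : ∀ t > 0, ContinuousOn (fun c => cdf M c t) (Ici 0))
    (hderiv : ∀ t > 0, ∀ c > 0, deriv (deriv fun c => cdf M c t) c < 0) {c : ℝ≥0}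
    (hmax : ∀ c' ≥ 0, ∫ t, expected (infoValue (n := n) M) (fun _ => cdf M c' t) ∂timeMeasure M -
      n * c' ≤ ∫ t, expected (infoValue (n := n) M) (fun _ => cdf M c t) ∂timeMeasure M - n * c) :
    IsStrictPBE M (fun _ : Fin n => truthfulTimely n M c) := by
  have := isFiniteMeasure_timeMeasure hint
  set σ : Profile n 𝒴 𝒳 := fun _ => truthfulTimely n M c with hσ
  intro i
  have hself : deviate σ i (truthfulTimely n M c) = σ := Function.update_eq_self i σ
  have hresp : ∀ x : ℝ, 0 ≤ x → x ≠ c → responsePayoff M i c x < responsePayoff M i c c :=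
    fun x hx hne => responsePayoff_lt hscore hcont hderiv c.2 hmax i hx hne
  have hresp' : ∀ x : ℝ, 0 ≤ x → responsePayoff M i c x ≤ responsePayoff M i c c := by
    intro x hx
    rcases eq_or_ne x c with rfl | hne
    · exact le_rfl
    · exact (hresp x hx hne).le
  have hutil : utility M σ i = responsePayoff M i c c := by
    have h := (integral_reward_sub_effort (M := M) hmeas hpos hint c i (truthfulTimely n M c)
      (integrable_const (c : ℝ)) (integrable_const (c : ℝ))).2
    rw [← hσ, hself] at h
    rw [utility]
    refine h.trans ?_
    simp [truthfulTimely]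
  refine ⟨?_, fun τ hτ => ?_, fun θ hθ hreach τ hτe hbefore hτ => ?_⟩
  · exact (integral_reward_truthful (M := M) hpos hint hmeas σ c i).1.sub
      (integrable_const (c : ℝ))
  · obtain ⟨he, hle, hlt⟩ := payoff_deviate_compare hscore hmeas hpos hint c i τ hτ
    rw [← hσ] at hle hlt
    have heU := integrable_effort_of_seed _ τ i he
    obtain ⟨hRi, hR⟩ := integral_reward_sub_effort (M := M) hmeas hpos hint c i τ heU he
    rw [← hσ] at hR
    rw [hR] at hle hlt
    obtain ⟨hL, hL'⟩ := lintegral_lossOf_truthful_le hscore hmeas hpos hint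
      (deviate σ i τ) (deviate σ i τ) c (θ := fun _ => 0) measurable_const
      (fun _ _ _ _ h => h) (fun ω t ht => marketBelief_congr _ (by
        rw [nonpos_iff_eq_zero.1 ht]
        funext j
        simp [before]))
    simp only [ENNReal.zero_lt_top, ofPred_true, Measure.restrict_univ, true_and] at hL hL'
    have hE : ∫ u, responsePayoff M i c (τ.effort u) ≤ responsePayoff M i c c := by
      refine (integral_mono hRi (integrable_const _) fun u => hresp' _ (τ.effort u).2).trans ?_
      simp
    refine ⟨((hle hL).trans hE).trans_eq hutil.symm, fun hne => ?_⟩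
    rw [hutil]
    by_cases heff : ∀ᵐ ω ∂law M (deviate σ i τ),
        τ.effort (ω.2 i).2.1 = (σ i).effort (ω.2 i).2.1
    · simp only [SamePlay, heff, true_and, not_forall] at hne
      obtain ⟨t, ht, hne⟩ := hne
      rw [ae_iff] at hne
      exact (hlt (hL' t ht hne)).trans_le hE
    · refine (hle hL).trans_lt (lt_of_le_of_ne hE fun heq => heff ?_)
      have hc : ∫ u, responsePayoff M i c (τ.effort u) =
          ∫ _ : unitInterval, responsePayoff M i c c := by simp [heq]
      have hae := (integral_eq_iff_of_ae_le hRi (integrable_const _)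
        (.of_forall fun u => hresp' _ (τ.effort u).2)).1 hc
      have hae' : ∀ᵐ u : unitInterval, τ.effort u = c := by
        filter_upwards [hae] with u hu
        by_contra hne
        exact (hresp _ (τ.effort u).2 fun h => hne (NNReal.coe_injective h)).ne hu
      rw [← map_seed_law (M := M) (deviate σ i τ) i] at hae'
      exact ae_of_ae_map (measurable_fst.comp (measurable_snd.comp
        ((measurable_pi_apply i).comp measurable_snd))).aemeasurable hae'
  · have hE : MeasurableSet {ω | θ ω < ∞} := measurableSet_lt hθ.1 measurable_const
    have hk0 : (law M σ {ω | θ ω < ∞})⁻¹ ≠ 0 := ENNReal.inv_ne_zero.2 (measure_ne_top _ _)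
    have hk1 : (law M σ {ω | θ ω < ∞})⁻¹ ≠ ∞ := ENNReal.inv_ne_top.2 hreach
    have hkpos : 0 < ((law M σ {ω | θ ω < ∞})⁻¹).toReal := ENNReal.toReal_pos hk0 hk1
    simp only [SamePlay, ProbabilityTheory.cond, integral_smul_measure, smul_eq_mul] at hτ ⊢
    rw [integrable_smul_measure hk0 hk1] at hτ
    obtain ⟨-, hle, hlt⟩ := payoff_deviate_compare hscore hmeas hpos hint c i τ hτ
    rw [← hσ] at hle hlt
    have hpay : (fun ω : World n 𝒴 𝒳 => reward M.prior M.score M.weight (play σ ω.2) i ω.1 -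
        τ.effort (ω.2 i).2.1) = payoff M σ i := by
      funext ω
      rw [payoff, hτe]
    rw [hpay] at hle hlt
    obtain ⟨hL, hL'⟩ := lintegral_lossOf_truthful_le hscore hmeas hpos hint
      σ (deviate σ i τ) c hθ.1
      (fun t ω ω' h hlt => ((hθ.2 (θ ω) (hlt.trans ENNReal.ofReal_lt_top) ω ω'
        (view_truthfulTimely_congr c i hlt h)).1 le_rfl).trans_lt hlt)
      (fun ω t ht => marketBelief_congr _ (before_congr_of_le ht (hbefore ω)))
    refine ⟨mul_le_mul_of_nonneg_left (hle hL) hkpos.le, fun hne => ?_⟩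
    refine mul_lt_mul_of_pos_left (hlt ?_) hkpos
    simp only [hτe, Filter.eventually_true, true_and, not_forall] at hne
    obtain ⟨t, ht, hne⟩ := hne
    rw [Measure.ae_ennreal_smul_measure_iff hk0, ae_restrict_iff' hE, ae_iff] at hne
    refine hL' t ht ?_
    convert hne using 3
    ext ω
    simp [hσ]

end Equilibrium

/-! ### Social optimality -/

section SocialOptimum

variable {n : ℕ} {𝒴 𝒳 : Type*} [Fintype 𝒴] [Fintype 𝒳] [MeasurableSpace 𝒳] {M : Model 𝒴 𝒳}
  [IsMarkovKernel M.latency]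

/-- The expected value of information is increasing in the common probability of arrival, which
by concavity is at most what it is for the mean effort. -/
lemma integral_expected_arrivalProb_le (hscore : StrictlyProper M.score)
    (hint : IntegrableOn M.weight (Ioi 0))
    (hcont : ∀ t > 0, ContinuousOn (fun c => cdf M c t) (Ici 0))
    (hderiv : ∀ t > 0, ∀ c > 0, deriv (deriv fun c => cdf M c t) c < 0)
    (s : Strategy n 𝒴 𝒳) (hs : Integrable fun u => (s.effort u : ℝ)) :
    ∫ t, expected (infoValue (n := n) M) (fun _ => arrivalProb M s t) ∂timeMeasure M ≤
      ∫ t, expected (infoValue (n := n) M) (fun _ => cdf M (∫ u, (s.effort u : ℝ)) t)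
        ∂timeMeasure M := by
  have := isFiniteMeasure_timeMeasure hint
  have hmono : MonotoneOn (fun s => expected (infoValue (n := n) M) fun _ => s) (Icc 0 1) := by
    refine monotoneOn_Icc_of_hasDerivAt (n := 1)
      (D := fun s => ∑ i, marginal (infoValue (n := n) M) (fun _ => s) i)
      (fun s => by simpa using hasDerivAt_expected_diag (infoValue (n := n) M) s)
      (fun s hs => Finset.sum_nonneg fun i _ =>
        marginal_nonneg (monotone_infoValue hscore) (fun _ => hs) i) zero_le_one
  obtain ⟨K, hK⟩ := (Set.finite_range fun A => |infoValue (n := n) M A|).bddAbove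
  have hbd : ∀ g : ℝ, g ∈ Icc (0 : ℝ) 1 → ‖expected (infoValue (n := n) M) fun _ => g‖ ≤ K :=
    fun g hg => abs_expected_le (fun A => hK ⟨A, rfl⟩) fun _ => hg
  have hexpc : Continuous fun s => expected (infoValue (n := n) M) fun _ => s :=
    continuous_iff_continuousAt.2 fun s => (hasDerivAt_expected_diag _ s).continuousAt
  have hcm : ∀ y : ℝ, Measurable fun t => cdf M y t := fun y =>
    measurable_cdf.comp (f := fun t => (y, t)) measurable_prodMk_left
  have hpm : Measurable fun t => expected (infoValue M) fun _ : Fin n => arrivalProb M s t := by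
    simp only [← integral_arrived fun _ : Fin n => s]
    exact (measurable_comp_arrived (infoValue M)).stronglyMeasurable.integral_prod_right.measurable
  refine integral_mono_ae ?_ ?_ ?_
  · exact Integrable.of_bound hpm.aestronglyMeasurable K (.of_forall fun t =>
      hbd _ (arrivalProb_mem_Icc _ _))
  · exact Integrable.of_bound (hexpc.measurable.comp (hcm _)).aestronglyMeasurable K
      (.of_forall fun t => hbd _ (cdf_mem_Icc _ _))
  · filter_upwards [ae_arrivalProb_le hcont hderiv s hs] with t ht
    exact hmono (arrivalProb_mem_Icc _ _) (cdf_mem_Icc _ _) ht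

variable [MeasurableSpace 𝒴] [DiscreteMeasurableSpace 𝒴] [DiscreteMeasurableSpace 𝒳]

/-- A symmetric profile does not achieve more than truthful and timely reports with the same
efforts, and by concavity these do not achieve more than with the mean effort. -/
theorem isSociallyOptimal_truthfulTimely (hscore : StrictlyProper M.score)
    (hmeas : ∀ y, Measurable fun p => M.score p y) (hpos : ∀ t > 0, 0 < M.weight t)
    (hint : IntegrableOn M.weight (Ioi 0))
    (hcont : ∀ t > 0, ContinuousOn (fun c => cdf M c t) (Ici 0))
    (hderiv : ∀ t > 0, ∀ c > 0, deriv (deriv fun c => cdf M c t) c < 0) {c : ℝ≥0}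
    (hmax : ∀ c' ≥ 0, ∫ t, expected (infoValue (n := n) M) (fun _ => cdf M c' t) ∂timeMeasure M -
      n * c' ≤ ∫ t, expected (infoValue (n := n) M) (fun _ => cdf M c t) ∂timeMeasure M - n * c) :
    IsSociallyOptimal M (fun _ : Fin n => truthfulTimely n M c) := by
  have := isFiniteMeasure_timeMeasure hint
  obtain ⟨hint₀, hW⟩ := welfare_truthfulTimely (n := n) (M := M) hpos hint c
  refine ⟨fun _ _ => rfl, hint₀, fun σ' hsym hσ' => ?_⟩
  rcases isEmpty_or_nonempty (Fin n) with hn | ⟨⟨i₀⟩⟩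
  · rw [Subsingleton.elim σ' fun _ => truthfulTimely n M c]
  obtain ⟨s, rfl⟩ : ∃ s : Strategy n 𝒴 𝒳, σ' = fun _ => s := ⟨σ' i₀, funext fun j => hsym j i₀⟩
  set σ' : Profile n 𝒴 𝒳 := fun _ => s with hs
  obtain ⟨C, hC⟩ := exists_abs_bestScore_le M
  obtain ⟨B, hB⟩ := exists_lossOf_truthful_le (n := n) (M := M) c
  let e : World n 𝒴 𝒳 → ℝ := fun ω => ∑ j, (s.effort (ω.2 j).2.1 : ℝ)
  let b : World n 𝒴 𝒳 → ℝ := fun ω => bestScore M ω.1 * (timeMeasure M).real univ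
  have he0 : ∀ ω, 0 ≤ e ω := fun ω => Finset.sum_nonneg fun j _ => (s.effort _).2
  have hem : Measurable e := Finset.measurable_fun_sum _ fun j _ => measurable_effort_seed s j
  have hbm : Measurable b := ((measurable_bestScore M).comp measurable_fst).mul_const _
  have hbC : ∀ ω, |b ω| ≤ C * (timeMeasure M).real univ := fun ω => by
    rw [abs_mul, abs_of_nonneg (measureReal_nonneg (s := univ))]
    exact mul_le_mul_of_nonneg_right (hC _) measureReal_nonneg
  have hsurplus : surplus M σ' = fun ω => (b ω - e ω) - (lossOf M σ' ω).toReal := by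
    funext ω
    rw [surplus, value_eq hscore hmeas hpos hint]
    simp only [b, e, hs]
    ring
  have hw' : welfare M σ' = ∫ ω, ((b ω - e ω) - (lossOf M σ' ω).toReal) ∂law M σ' := by
    rw [welfare, hsurplus]
  rw [hsurplus] at hσ'
  rw [hw']
  obtain ⟨h1, h2, h3, -⟩ := integral_sub_toReal_le (A := C * (timeMeasure M).real univ) (B := B)
    (a := fun ω => b ω - e ω) (L' := lossOf M σ') (hbm.sub hem) (fun ω => (sub_le_self _ (he0 ω)).trans (abs_le.1 (hbC ω)).2)
    (measurable_lossOf hmeas _) hB (measurable_lossOf hmeas _) (lossOf_ne_top _) hσ'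
  have hL := (lintegral_lossOf_truthful_le hscore hmeas hpos hint σ' σ' c (θ := fun _ => 0)
    measurable_const (fun _ _ _ _ h => h) (fun ω t ht => marketBelief_congr _ (by
        rw [nonpos_iff_eq_zero.1 ht]
        funext j
        simp [before]))).1
  simp only [ENNReal.zero_lt_top, ofPred_true, Measure.restrict_univ] at hL
  refine (h3 hL).trans ?_
  obtain ⟨hVi, hV⟩ := integral_value_truthful (M := M) hpos hint σ' c
  have heq : ∀ ω, (b ω - e ω) - (lossOf M (fun _ => truthfulTimely n M c) ω).toReal =
      value M.prior M.score M.weight (play (fun _ => truthfulTimely n M c) ω.2) ω.1 - e ω := by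
    intro ω
    rw [value_eq hscore hmeas hpos hint]
    ring
  have hei : Integrable e (law M σ') := by
    have hbi : Integrable b (law M σ') :=
      Integrable.of_bound hbm.aestronglyMeasurable _ (.of_forall hbC)
    refine (hbi.sub h1).congr (.of_forall fun ω => ?_)
    simp
  have hej : ∀ j, Integrable (fun ω : World n 𝒴 𝒳 => (s.effort (ω.2 j).2.1 : ℝ)) (law M σ') := by
    intro j
    refine hei.mono' (measurable_effort_seed s j).aestronglyMeasurable (.of_forall fun ω => ?_)
    rw [Real.norm_of_nonneg (NNReal.coe_nonneg _)]
    exact Finset.single_le_sum (f := fun j => (s.effort (ω.2 j).2.1 : ℝ))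
      (fun j _ => NNReal.coe_nonneg _) (Finset.mem_univ j)
  have hsU := integrable_effort_of_seed σ' s i₀ (hej i₀)
  set x : ℝ := ∫ u, (s.effort u : ℝ) with hx
  have hx0 : 0 ≤ x := integral_nonneg fun u => NNReal.coe_nonneg _
  have heI : ∫ ω, e ω ∂law M σ' = n * x := by
    rw [integral_finsetSum _ fun j _ => hej j]
    simp [integral_effort_seed, hx]
  simp only [heq]
  rw [integral_sub hVi hei, hV, heI, hW]
  exact (sub_le_sub_right (integral_expected_arrivalProb_le hscore hint hcont hderiv s hsU) _).trans
    (hmax x hx0)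

end SocialOptimum

end MVP

theorem theorem2 {𝒴 𝒳 : Type*} [Fintype 𝒴] [MeasurableSpace 𝒴] [DiscreteMeasurableSpace 𝒴]
    [Fintype 𝒳] [MeasurableSpace 𝒳] [DiscreteMeasurableSpace 𝒳]
    (n : ℕ) (M : MVP.Model 𝒴 𝒳) [IsMarkovKernel M.latency]
    (hscore : MVP.StrictlyProper M.score)
    (hscore_meas : ∀ y, Measurable fun p => M.score p y)
    (hweight_pos : ∀ t > 0, 0 < M.weight t)
    (hweight_int : IntegrableOn M.weight (Ioi 0))
    (hcdf_cont : ∀ t > 0, ContinuousOn (fun c => MVP.cdf M c t) (Ici 0))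
    (hcdf_deriv : ∀ t > 0, ∀ c > 0, deriv (deriv fun c => MVP.cdf M c t) c < 0) :
    MVP.IndividuallyRational n M ∧
      ∃ σ : MVP.Profile n 𝒴 𝒳,
        MVP.IsStrictPBE M σ ∧ MVP.IsSociallyOptimal M σ ∧
        MVP.IsEffortOptimal M σ ∧ MVP.IsTruthful M σ ∧ MVP.IsTimely σ := by
  have := MVP.isFiniteMeasure_timeMeasure hweight_int
  obtain ⟨c, hmax⟩ := MVP.exists_optimal_common_effort hweight_int hcdf_cont n
  refine ⟨MVP.individuallyRational M, fun _ => MVP.truthfulTimely n M c,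
    MVP.isStrictPBE_truthfulTimely hscore hscore_meas hweight_pos hweight_int hcdf_cont
      hcdf_deriv hmax,
    MVP.isSociallyOptimal_truthfulTimely hscore hscore_meas hweight_pos hweight_int hcdf_cont
      hcdf_deriv hmax, ⟨c, fun _ _ => rfl, fun c' => ?_⟩, fun w i hi => ?_, fun w i => ?_⟩
  · rw [(MVP.welfare_truthfulTimely hweight_pos hweight_int c).2,
      (MVP.welfare_truthfulTimely hweight_pos hweight_int c').2]
    exact hmax c' c'.2
  · rw [MVP.play_truthfulTimely M rfl] at hi ⊢
    split_ifs at hi ⊢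
    · rfl
    · exact absurd hi (lt_irrefl _)
  · rw [MVP.play_truthfulTimely M rfl]
    split_ifs with h
    · rfl
    · exact (not_lt_top_iff.1 h).symm
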